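/- Let $d\ge 2$. Let $(\eta_i)_{i\in\mathbb Z}$ be i.i.d. real random variables and $(\delta_x)_{x\in\mathbb Z^d}$ i.i.d. integer-valued random variables, the two families being independent. Assume $E[\eta_0]=0$, $\mathrm{Var}(\eta_0)>0$, and that $|\eta_0|$ and $|\delta_0|$ are almost surely bounded. Let $P_e$ be the law of the environment $\omega=((\eta_i)_i,(\delta_x)_x)$. Put $S_0=0$, $S_k=\sum_{i=1}^k\eta_i$ for $k>0$ and $S_k=-\sum_{i=k+1}^0\eta_i$ for $k<0$. With $\bar x=\max_j|x_j|$, let $V(x)=S_{\bar x+\delta_x}$ if $\bar x+\delta_x\ge 0$ and $V(x)=0$ otherwise. Write $x\sim y$ if $x=y\pm e_i$ for some vector $e_i$ of the canonical basis. Let $\pi(x,y)=e^{-V(x)/2-V(y)/2}\mathbf 1_{x\sim y}$ and $\pi(x)=\sum_z\pi(x,z)$. Let $P^V_0$ be the law of the Markov chain $(X_n)_{n\ge0}$ on $\mathbb Z^d$ with $X_0=0$ and transition probabilities $p(x,y)=\pi(x,y)/\pi(x)$. For a finite set $U\subset\mathbb Z^d$ let $L(U,n)=\#\{1\le i\le n: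 X_i\in U\}$. Let $B_p=\{x\in\mathbb Z^d:\bar x\le p\}$ and $C_p=B_p\setminus B_{p-1}$. Let $\pi^j_p$ $(1\le j\le n_d(p))$ be the distinct values of $\pi$ on $C_p$, and let $C^j_p=\{x\in C_p:\pi(x)=\pi^j_p\}$; here $n_d(p)$, $\pi^j_p$ and $C^j_p$ depend on the environment. Let $$M_n=\inf\Big\{k>0:\ S_k-\min_{0\le i\le k}S_i\ge\log n+(\log n)^{1/2}\Big\},\qquad m_n=\inf\Big\{k>0:\ S_k=\min_{0\le i\le M_n}S_i\Big\},$$ $$R^j_p=\frac{|C^j_p|\,\pi^j_p}{\sum_{x\in B_{M_n}}\pi(x)} .$$ **Proposition.** Let $\mathcal E^0=\{z\in\mathbb Z:P(\delta_0=z)>0\}$ and $\mathcal E=\{z-1,z,z+1:z\in\mathcal E^0\}$. There are finitely many vectors $a^i=(a^i_0,\dots,a^i_{2d})$, $1\le i\le N$, with $a^i_0\in\mathcal E^0$ and all entries in $\mathcal E$, and an integer $p_0$, such that for every $\delta>0$ there are measurable sets $A_n$ of environments with $\lim_{n\to\infty}P_e(A_n)=1$ and the following properties. 1. For every $n$, every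 environment in $A_n$ and every $p\ge p_0$, each of the values $\pi^j_p$ is of the form $e^{-S_{p+a^i_0}/2}\sum_{r=1}^{2d}e^{-S_{p+a^i_r}/2}$ for some $i\in\{1,\dots,N\}$. 2. For every $k\in\mathbb N$, $$\lim_{n\to\infty}\ \inf_{\omega\in A_n}P^{V}_0\Big(\bigcap_{|l|\le k}\Big\{\Big|\tfrac{L(C_{m_n+l},n)}{n}-\sum_{j}R^j_{m_n+l}\Big|\le\delta\sum_{j}R^j_{m_n+l}\Big\}\Big)=1 .$$ 3. For every $k\in\mathbb N$, $$\lim_{n\to\infty}\ \inf_{\omega\in A_n}P^{V}_0\Big(\bigcap_{|l|\le k}\ \bigcap_{j}\Big\{\Big|\tfrac{L(C^j_{m_n+l},n)}{n}-R^j_{m_n+l}\Big|\le\delta R^j_{m_n+l}\Big\}\Big)=1 .$$ In 2 and 3, $j$ runs over $1,\dots,n_d(m_n+l)$. -/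

import Mathlib

open MeasureTheory ProbabilityTheory Filter Topology

noncomputable section

namespace HypercubeRWRE

/-- The lattice `ℤ^d`. -/
abbrev Site (d : ℕ) : Type := Fin d → ℤ

/-- The supremum norm `max_j |x_j|` on `ℤ^d`. -/
def supNorm {d : ℕ} (x : Site d) : ℕ := Finset.univ.sup fun i => (x i).natAbs

/-- The sites that differ from `x` by plus or minus one vector of the canonical basis. -/
def neighbors {d : ℕ} (x : Site d) : Finset (Site d) :=
  Finset.univ.image (fun i : Fin d => x + Pi.single i 1) ∪
    Finset.univ.image (fun i : Fin d => x - Pi.single i 1)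

/-! ### The random environment -/

/-- An environment: the increments `(η_i)_{i ∈ ℤ}` and the shifts `(δ_x)_{x ∈ ℤ^d}`. -/
abbrev Env (d : ℕ) : Type := (ℤ → ℝ) × (Site d → ℤ)

/-- The law of the environment: the `η_i` are i.i.d. with law `μη`, the `δ_x` are i.i.d. with
law `μδ`, and the two families are independent. -/
def envLaw (d : ℕ) (μη : Measure ℝ) [IsProbabilityMeasure μη]
    (μδ : Measure ℤ) [IsProbabilityMeasure μδ] : Measure (Env d) :=
  (Measure.infinitePi fun _ : ℤ => μη).prod (Measure.infinitePi fun _ : Site d => μδ)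

/-- The two-sided walk `S_k`. -/
def walkS {d : ℕ} (ω : Env d) (k : ℤ) : ℝ :=
  if 0 ≤ k then ∑ i ∈ Finset.Icc 1 k, ω.1 i else ∑ i ∈ Finset.Icc (k + 1) 0, -ω.1 i

/-- The potential `V`. -/
def potential {d : ℕ} (ω : Env d) (x : Site d) : ℝ :=
  if 0 ≤ (supNorm x : ℤ) + ω.2 x then walkS ω ((supNorm x : ℤ) + ω.2 x) else 0

/-- `min_{0 ≤ i ≤ k} S_i`. -/
def runningMin {d : ℕ} (ω : Env d) (k : ℕ) : ℝ :=
  (Finset.range (k + 1)).inf' Finset.nonempty_range_add_one fun i => walkS ω (i : ℤ)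

/-- `M_n`, the top of the valley: the first `k > 0` at which `S` exceeds its running minimum by at
least `log n + (log n)^(1/2)`. (The set is almost surely nonempty for a centred nondegenerate
walk.) -/
def topM {d : ℕ} (ω : Env d) (n : ℕ) : ℕ :=
  sInf {k : ℕ | 0 < k ∧ Real.log n + Real.sqrt (Real.log n) ≤ walkS ω (k : ℤ) - runningMin ω k}

/-- `m_n`, the bottom of the valley: the first `k > 0` at which `S` takes the value
`min_{0 ≤ i ≤ M_n} S_i`. (The set is nonempty with probability tending to one.) -/
def bottomM {d : ℕ} (ω : Env d) (n : ℕ) : ℕ :=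
  sInf {k : ℕ | 0 < k ∧ walkS ω (k : ℤ) = runningMin ω (topM ω n)}

/-! ### The random walk in a fixed environment -/

/-- The conductance `π(x, y)`. -/
def conductance {d : ℕ} (V : Site d → ℝ) (x y : Site d) : ℝ :=
  if y ∈ neighbors x then Real.exp (-(1 / 2) * V x - (1 / 2) * V y) else 0

/-- The reversible measure `π(x) = ∑_z π(x, z)`. -/
def revMeasure {d : ℕ} (V : Site d → ℝ) (x : Site d) : ℝ :=
  ∑ z ∈ neighbors x, conductance V x z

/-- The transition probability `p(x, y) = π(x, y) / π(x)`. -/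
def transProb {d : ℕ} (V : Site d → ℝ) (x y : Site d) : ℝ :=
  conductance V x y / revMeasure V x

lemma conductance_nonneg {d : ℕ} (V : Site d → ℝ) (x y : Site d) : 0 ≤ conductance V x y := by
  unfold conductance
  split_ifs <;> positivity

lemma revMeasure_pos {d : ℕ} [NeZero d] (V : Site d → ℝ) (x : Site d) : 0 < revMeasure V x := by
  have h : x + Pi.single (0 : Fin d) 1 ∈ neighbors x :=
    Finset.mem_union_left _ (Finset.mem_image_of_mem _ (Finset.mem_univ _))
  refine Finset.sum_pos' (fun z _ => conductance_nonneg V x z) ⟨_, h, ?_⟩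
  rw [conductance, if_pos h]
  positivity

/-- The one-step transition kernel: from `x` the walk jumps to `y` with probability `p(x, y)`. -/
def stepKernel {d : ℕ} (V : Site d → ℝ) : Kernel (Site d) (Site d) :=
  Kernel.ofFunOfCountable fun x =>
    ∑ y ∈ neighbors x, ENNReal.ofReal (transProb V x y) • Measure.dirac y

instance stepKernel_isMarkov {d : ℕ} [NeZero d] (V : Site d → ℝ) :
    IsMarkovKernel (stepKernel V) := by
  refine ⟨fun x => ⟨?_⟩⟩
  have hx := revMeasure_pos V x
  have h1 : ∑ y ∈ neighbors x, transProb V x y = 1 := by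
    simp only [transProb]
    rw [← Finset.sum_div]
    exact div_self hx.ne'
  show (∑ y ∈ neighbors x, ENNReal.ofReal (transProb V x y) • Measure.dirac y) Set.univ = 1
  rw [Measure.finsetSum_apply]
  simp only [Measure.smul_apply, measure_univ, smul_eq_mul, mul_one]
  rw [← ENNReal.ofReal_sum_of_nonneg, h1, ENNReal.ofReal_one]
  exact fun y _ => div_nonneg (conductance_nonneg V x y) hx.le

/-- The one-step kernel as a function of the whole past; only the present position matters. -/
def historyKernel {d : ℕ} (V : Site d → ℝ) (n : ℕ) :
    Kernel (Π _ : Finset.Iic n, Site d) (Site d) :=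
  (stepKernel V).comap (fun h => h ⟨n, Finset.mem_Iic.2 le_rfl⟩) (measurable_pi_apply _)

instance historyKernel_isMarkov {d : ℕ} [NeZero d] (V : Site d → ℝ) (n : ℕ) :
    IsMarkovKernel (historyKernel V n) := by
  unfold historyKernel
  infer_instance

/-- The quenched law: the law on trajectories of the Markov chain with transition probabilities
`p(x, y)` and `X_0 = z`. -/
def quenchedLaw {d : ℕ} [NeZero d] (V : Site d → ℝ) (z : Site d) : Measure (ℕ → Site d) :=
  Kernel.traj (X := fun _ => Site d) (historyKernel V) 0 (fun _ => z)

/-- The local time `L(x, n) = ∑_{k=1}^n 1_{X_k = x}`. -/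
def localTime {d : ℕ} (X : ℕ → Site d) (x : Site d) (n : ℕ) : ℝ :=
  ∑ k ∈ Finset.Icc 1 n, if X k = x then 1 else 0

/-- The local time `L(U, n) = ∑_{x ∈ U} L(x, n)` of a finite set `U`. -/
def localTimeOn {d : ℕ} (X : ℕ → Site d) (U : Finset (Site d)) (n : ℕ) : ℝ :=
  ∑ x ∈ U, localTime X x n

/-! ### Hypercubes and level sets of the reversible measure -/

/-- The box `B_k = {y : max_j |y_j| ≤ k}`. -/
def box (d : ℕ) (k : ℤ) : Finset (Site d) := Fintype.piFinset fun _ => Finset.Icc (-k) k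

/-- The hypercube `C_k = B_k \ B_{k-1}`. -/
def shell (d : ℕ) (k : ℤ) : Finset (Site d) := box d k \ box d (k - 1)

/-- The finite set of the distinct values of `π` on `C_k`. -/
def levelValues {d : ℕ} (V : Site d → ℝ) (k : ℤ) : Finset ℝ := (shell d k).image (revMeasure V)

/-- The level set `{x ∈ C_k : π(x) = v}`. -/
def levelSet {d : ℕ} (V : Site d → ℝ) (k : ℤ) (v : ℝ) : Finset (Site d) :=
  (shell d k).filter fun x => revMeasure V x = v

/-- The weight `|{x ∈ C_p : π(x) = v}| v / ∑_{x ∈ B_M} π(x)`. -/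
def weight {d : ℕ} (V : Site d → ℝ) (M p : ℤ) (v : ℝ) : ℝ :=
  ((levelSet V p v).card : ℝ) * v / ∑ x ∈ box d M, revMeasure V x

/-! ### The form of the values of the reversible measure -/

/-- The state space of `δ_0`. -/
def shiftSupport (μδ : Measure ℤ) : Set ℤ := {z | 0 < μδ {z}}

/-- The set of all `z - 1`, `z`, `z + 1` with `z` in the state space of `δ_0`. -/
def extShiftSupport (μδ : Measure ℤ) : Set ℤ :=
  {a | ∃ z ∈ shiftSupport μδ, a = z - 1 ∨ a = z ∨ a = z + 1}

/-- `exp(-S_{p + a_0} / 2) ∑_{i=1}^{2d} exp(-S_{p + a_i} / 2)`. -/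
def formValue {d : ℕ} (ω : Env d) (p : ℤ) (a : Fin (2 * d + 1) → ℤ) : ℝ :=
  Real.exp (-(1 / 2) * walkS ω (p + a 0)) *
    ∑ i : Fin (2 * d), Real.exp (-(1 / 2) * walkS ω (p + a i.succ))

end HypercubeRWRE

end

open HypercubeRWRE

namespace HypercubeRWRE

/-! Write `y = √(log n)`. With probability tending to one the walk `S` forms a valley on `[0, M_n]`:
its width is polynomial in `y`, its top lies at least `log n + y` above the bottom `m_n`, and a path
moving radially towards `m_n` never climbs more than `log n - y` (`isValley_of_good`,
`measure_compl_goodEnv_le`). This follows from gambler's ruin bounds for bounded centred steps.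
Bounded shifts make `V(x)` differ from `S` at the radius of `x` by a bounded amount only.

The quenched part uses nothing but `IsValley`. Reversibility bounds the probability of reaching the
outer hypercube within `n` steps by `n` times the ratio of the masses at top and bottom, which is
`e^{-y}` up to a polynomial in `y` (`IsValley.exitProb_le`). Inside the box, the Poisson equation `g
- Pg = 1_x - ρ`, with `ρ` the normalised mass of `x`, has a solution bounded by effective
resistances. Lattice paths to the corner `(m, …, m)` that stay between two hypercubes bound these
resistances, so `g` is at most `n e^{-y}` times a polynomial in `y` (`IsValley.exists_poisson`). The
centred local time of `x` is then a martingale up to the bounded term `g`, and a second moment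
estimate gives relative error `δ`, because `ρ` is at least an inverse polynomial in `y` near the
bottom (`IsValley.localTime_concentration`, `IsValley.le_mass`). Every error is a polynomial in `y`
times `e^{-y}`, which leaves room for a union bound over sites and makes the estimate uniform over
good environments (`exists_quenched_bound`).

Relative errors add up over sites, so both limit statements follow from the one for single sites.
The form of the values of `π` is read off from the definition of `V` once `p` exceeds the bound on
the shifts (`exists_formValue`). -/

/-! ### Supermartingale bounds for the quenched chain. -/

lemma lintegral_stepKernel {d : ℕ} (V : Site d → ℝ) (x : Site d) (F : Site d → ENNReal) :
    ∫⁻ y, F y ∂stepKernel V x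
      = ∑ y ∈ neighbors x, ENNReal.ofReal (transProb V x y) * F y := by
  change ∫⁻ y, F y ∂(∑ y ∈ neighbors x, ENNReal.ofReal (transProb V x y) • Measure.dirac y) = _
  rw [lintegral_finsetSum_measure]
  simp [lintegral_smul_measure]

/-- The Markov property at time `k`, for functionals of the trajectory up to time `k + 1`. -/
lemma lintegral_quenchedLaw_succ {d : ℕ} [NeZero d] (V : Site d → ℝ) (z : Site d) (k : ℕ)
    (Φ : (ℕ → Site d) → Site d → ENNReal)
    (hΦ : ∀ X X' : ℕ → Site d, (∀ i ≤ k, X i = X' i) → Φ X = Φ X') :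
    ∫⁻ X, Φ X (X (k + 1)) ∂quenchedLaw V z
      = ∫⁻ X, ∑ y ∈ neighbors (X k), ENNReal.ofReal (transProb V (X k) y) * Φ X y
          ∂quenchedLaw V z := by
  -- Factoring through the history up to time `k`, which lives in a countable space, makes every
  -- functional measurable.
  let ext : (Π _ : Finset.Iic k, Site d) → ℕ → Site d :=
    fun h i => if hi : i ≤ k then h ⟨i, Finset.mem_Iic.2 hi⟩ else 0
  have hext : ∀ X : ℕ → Site d, Φ (ext (Preorder.frestrictLe k X)) = Φ X := fun X =>
    hΦ _ _ fun i hi => by simp [ext, hi]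
  let F : (Π _ : Finset.Iic k, Site d) × Site d → ENNReal := fun p => Φ (ext p.1) p.2
  have hF : Measurable F := measurable_of_countable F
  have key := Kernel.partialTraj_compProd_eq_map_traj (X := fun _ => Site d)
    (κ := historyKernel V) (a := 0) (b := k) (Nat.zero_le k) (x₀ := fun _ => z)
  have h1 : ∫⁻ X, Φ X (X (k + 1)) ∂quenchedLaw V z
      = ∫⁻ p, F p ∂((quenchedLaw V z).map fun x => (Preorder.frestrictLe k x, x (k + 1))) := by
    rw [lintegral_map hF (by fun_prop)]
    simp only [F, hext]
  rw [h1, quenchedLaw, ← key, Measure.lintegral_compProd hF,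
    ← Kernel.traj_map_frestrictLe_apply, lintegral_map (measurable_of_countable _) (by fun_prop)]
  refine lintegral_congr fun X => ?_
  change ∫⁻ b, F (Preorder.frestrictLe k X, b) ∂(stepKernel V (X k)) = _
  rw [lintegral_stepKernel]
  simp only [F, hext]

/-- A supermartingale bound for the chain: `G` dominates `1` outside `D` and is superharmonic for
the chain in `D` together with the additive functional of `f`. -/
theorem quenchedLaw_le_of_superharmonic {d : ℕ} [NeZero d] (V : Site d → ℝ) (z : Site d)
    (D : Set (Site d)) (f : Site d → ℝ) (G : ℕ → Site d → ℝ → ENNReal)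
    (hG : ∀ j, ∀ x ∉ D, ∀ s, 1 ≤ G j x s)
    (hstep : ∀ j, ∀ x ∈ D, ∀ s,
      ∑ y ∈ neighbors x, ENNReal.ofReal (transProb V x y) * G j y (s + f x) ≤ G (j + 1) x s)
    (n : ℕ) :
    quenchedLaw V z {X | 1 ≤ G 0 (X n) (∑ i ∈ Finset.range n, f (X i)) ∨ ∃ i < n, X i ∉ D}
      ≤ G n z 0 := by
  classical
  -- The process is frozen at `1` from the first exit of `D` on; before that, `n - k` is the time
  -- left.
  let Z : ℕ → (ℕ → Site d) → Site d → ENNReal := fun k X y =>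
    if ∃ i < k, X i ∉ D then 1 else G (n - k) y (∑ i ∈ Finset.range k, f (X i))
  have hloc : ∀ k, ∀ X X' : ℕ → Site d, (∀ i < k, X i = X' i) → Z k X = Z k X' := by
    intro k X X' h
    have h1 : (∃ i < k, X i ∉ D) ↔ ∃ i < k, X' i ∉ D :=
      exists_congr fun i => and_congr_right fun hi => by rw [h i hi]
    have h2 : ∑ i ∈ Finset.range k, f (X i) = ∑ i ∈ Finset.range k, f (X' i) :=
      Finset.sum_congr rfl fun i hi => by rw [h i (Finset.mem_range.1 hi)]
    funext y
    simp only [Z, h1, h2]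
  have hsum : ∀ x, ∑ y ∈ neighbors x, ENNReal.ofReal (transProb V x y) = 1 := by
    intro x
    have := lintegral_stepKernel V x (fun _ => 1)
    simpa using this.symm
  have hdec : ∀ k ≤ n, ∫⁻ X, Z k X (X k) ∂quenchedLaw V z ≤ G n z 0 := by
    intro k
    induction k with
    | zero =>
      intro _
      have h0 : ∀ᵐ X ∂quenchedLaw V z, X 0 = z := by
        have h := Kernel.traj_map_frestrictLe_apply (X := fun _ => Site d)
          (κ := historyKernel V) 0 0 (fun _ => z)
        rw [Kernel.partialTraj_self, Kernel.id_apply] at h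
        have h2 : ∀ᵐ Y ∂((quenchedLaw V z).map (Preorder.frestrictLe 0)),
            Y = (fun _ => z) := by
          rw [quenchedLaw, h, ae_dirac_eq]
          exact Filter.eventually_pure.2 rfl
        filter_upwards [ae_of_ae_map (by fun_prop) h2] with X hX
        exact congrFun hX ⟨0, by simp⟩
      calc ∫⁻ X, Z 0 X (X 0) ∂quenchedLaw V z
          = ∫⁻ X, G n z 0 ∂quenchedLaw V z := by
            refine lintegral_congr_ae ?_
            filter_upwards [h0] with X hX
            simp [Z, hX]
        _ ≤ G n z 0 := by
            have : IsProbabilityMeasure (quenchedLaw V z) := by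
              unfold quenchedLaw; infer_instance
            simp
    | succ k ih =>
      intro hk
      refine le_trans ?_ (ih (by omega))
      rw [lintegral_quenchedLaw_succ V z k (Z (k + 1))
        fun X X' h => hloc _ _ _ fun i hi => h i (by omega)]
      refine lintegral_mono fun X => ?_
      by_cases h1 : ∃ i < k, X i ∉ D
      · have h2 : ∃ i < k + 1, X i ∉ D := let ⟨i, hi, h⟩ := h1; ⟨i, by omega, h⟩
        simp only [Z, if_pos h1, if_pos h2, mul_one, hsum, le_refl]
      · by_cases h3 : X k ∈ D
        · have h2 : ¬ ∃ i < k + 1, X i ∉ D := by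
            rintro ⟨i, hi, h⟩
            rcases Nat.lt_succ_iff_lt_or_eq.1 hi with h' | rfl
            · exact h1 ⟨i, h', h⟩
            · exact h h3
          simp only [Z, h1, h2, if_false]
          rw [Finset.sum_range_succ]
          have := hstep (n - (k + 1)) (X k) h3 (∑ i ∈ Finset.range k, f (X i))
          rwa [show n - (k + 1) + 1 = n - k by omega] at this
        · have h2 : ∃ i < k + 1, X i ∉ D := ⟨k, by omega, h3⟩
          simp only [Z, h1, h2, if_true, if_false, mul_one, hsum]
          exact hG _ _ h3 _
  have hmeas : Measurable fun X : ℕ → Site d => Z n X (X n) := by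
    let ext : (Π _ : Finset.Iic n, Site d) → ℕ → Site d :=
      fun h i => if hi : i ≤ n then h ⟨i, Finset.mem_Iic.2 hi⟩ else 0
    have : (fun X : ℕ → Site d => Z n X (X n))
        = (fun h => Z n (ext h) (ext h n)) ∘ Preorder.frestrictLe n := by
      funext X
      simp only [Function.comp]
      rw [hloc n X (ext (Preorder.frestrictLe n X)) fun i hi => by simp [ext, hi.le]]
      simp [ext]
    rw [this]
    exact (measurable_of_countable _).comp (by fun_prop)
  refine le_trans ?_ (hdec n le_rfl)
  have := mul_meas_ge_le_lintegral (μ := quenchedLaw V z) hmeas 1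
  rw [one_mul] at this
  refine le_trans (measure_mono ?_) this
  intro X hX
  simp only [Set.mem_ofPred_eq] at hX ⊢
  by_cases h1 : ∃ i < n, X i ∉ D
  · simp [Z, h1]
  · simp only [Z, h1, if_false, Nat.sub_self]
    exact hX.resolve_right h1

/-! ### Green functions and the Poisson equation on finite networks. -/

section Network

variable {ι : Type*} [Fintype ι]

/-- The Laplacian of a finite weighted graph. -/
def netLap (c : ι → ι → ℝ) (φ : ι → ℝ) (x : ι) : ℝ := ∑ y, c x y * (φ x - φ y)

/-- The Dirichlet energy of a finite weighted graph. -/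
noncomputable def netEnergy (c : ι → ι → ℝ) (φ : ι → ℝ) : ℝ :=
  (1 / 2) * ∑ x, ∑ y, c x y * (φ x - φ y) ^ 2

/-- Summation by parts: average the double sum with its copy in which `x` and `y` are exchanged. -/
lemma sum_netLap_mul {c : ι → ι → ℝ} (hc : ∀ x y, c x y = c y x) (φ ψ : ι → ℝ) :
    ∑ x, netLap c φ x * ψ x = (1 / 2) * ∑ x, ∑ y, c x y * ((φ x - φ y) * (ψ x - ψ y)) := by
  have h1 : ∑ x, netLap c φ x * ψ x = ∑ x, ∑ y, c x y * (φ x - φ y) * ψ x := by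
    simp only [netLap, Finset.sum_mul]
  have h2 : ∑ x, netLap c φ x * ψ x = ∑ x, ∑ y, c x y * (φ y - φ x) * ψ y := by
    rw [h1, Finset.sum_comm]
    refine Finset.sum_congr rfl fun x _ => Finset.sum_congr rfl fun y _ => ?_
    rw [hc]
  have h3 : ∑ x, netLap c φ x * ψ x
      = (1 / 2) * (∑ x, netLap c φ x * ψ x + ∑ x, netLap c φ x * ψ x) := by ring
  rw [h3]
  nth_rw 1 [h1]
  rw [h2, ← Finset.sum_add_distrib]
  congr 1
  refine Finset.sum_congr rfl fun x _ => ?_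
  rw [← Finset.sum_add_distrib]
  exact Finset.sum_congr rfl fun y _ => by ring

/-- Applied to truncations `ψ` of `φ`, this yields the maximum principle in energy form. -/
lemma netEnergy_le_of_contraction {c : ι → ι → ℝ} (hc : ∀ x y, c x y = c y x)
    (h0 : ∀ x y, 0 ≤ c x y) (φ ψ : ι → ℝ)
    (h : ∀ x y, (ψ x - ψ y) ^ 2 ≤ (φ x - φ y) * (ψ x - ψ y)) :
    netEnergy c ψ ≤ ∑ x, netLap c φ x * ψ x := by
  rw [sum_netLap_mul hc, netEnergy]
  gcongr with x _ y _
  · exact h0 x y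
  · exact h x y

lemma sum_netLap {c : ι → ι → ℝ} (hc : ∀ x y, c x y = c y x) (φ : ι → ℝ) :
    ∑ x, netLap c φ x = 0 := by
  have := sum_netLap_mul hc φ fun _ => 1
  simpa using this

variable [DecidableEq ι]

/-- The Green function of a finite network, grounded at `z`. -/
lemma exists_green {c : ι → ι → ℝ} (hc : ∀ x y, c x y = c y x) (h0 : ∀ x y, 0 ≤ c x y)
    {r : ι → ℝ} {z : ι} (hr0 : ∀ y, 0 ≤ r y)
    (hr : ∀ y, ∀ φ : ι → ℝ, (φ y - φ z) ^ 2 ≤ r y * netEnergy c φ) (y : ι) :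
    ∃ φ : ι → ℝ, (∀ x, netLap c φ x = (if x = y then 1 else 0) - if x = z then 1 else 0) ∧
      ∀ x, 0 ≤ φ x ∧ φ x ≤ r y := by
  have hzero : ∀ ψ : ι → ℝ, netEnergy c ψ ≤ 0 → ∀ x, ψ x = ψ z := by
    intro ψ hψ x
    have h1 := hr x ψ
    have h2 : r x * netEnergy c ψ ≤ 0 := mul_nonpos_of_nonneg_of_nonpos (hr0 x) hψ
    nlinarith [sq_nonneg (ψ x - ψ z)]
  have hself : ∀ φ : ι → ℝ, ∑ x, netLap c φ x * φ x = netEnergy c φ := by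
    intro φ
    rw [sum_netLap_mul hc, netEnergy]
    simp only [sq]
  -- The Laplacian with its row at `z` replaced by evaluation at `z`. Grounding removes the
  -- constants from the kernel, so `A` is injective, hence onto.
  let A : (ι → ℝ) →ₗ[ℝ] (ι → ℝ) :=
    { toFun := fun φ x => if x = z then φ z else netLap c φ x
      map_add' := by
        intro φ ψ
        funext x
        simp only [Pi.add_apply]
        split_ifs
        · rfl
        · simp only [netLap, Pi.add_apply, ← Finset.sum_add_distrib]
          exact Finset.sum_congr rfl fun _ _ => by ring
      map_smul' := by
        intro a φ
        funext x
        simp only [Pi.smul_apply, smul_eq_mul, RingHom.id_apply]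
        split_ifs
        · rfl
        · simp only [netLap, Pi.smul_apply, smul_eq_mul, Finset.mul_sum]
          exact Finset.sum_congr rfl fun _ _ => by ring }
  have hA : ∀ φ x, A φ x = if x = z then φ z else netLap c φ x := fun _ _ => rfl
  have hinj : Function.Injective A := by
    refine (injective_iff_map_eq_zero A).2 fun φ hφ => ?_
    have h1 : φ z = 0 := by simpa [hA] using congrFun hφ z
    have h2 : ∀ x, netLap c φ x * φ x = 0 := by
      intro x
      by_cases hx : x = z
      · rw [hx, h1, mul_zero]
      · have := congrFun hφ x
        rw [hA, if_neg hx] at this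
        rw [this]; simp
    have h3 : netEnergy c φ ≤ 0 := by
      rw [← hself, Finset.sum_eq_zero fun x _ => h2 x]
    funext x
    rw [hzero φ h3 x, h1, Pi.zero_apply]
  obtain ⟨φ, hφ⟩ := LinearMap.injective_iff_surjective.1 hinj
    fun x => if x = z then 0 else if x = y then 1 else 0
  have hz : φ z = 0 := by simpa [hA] using congrFun hφ z
  have hoff : ∀ x, x ≠ z → netLap c φ x = if x = y then 1 else 0 := by
    intro x hx
    simpa [hA, hx] using congrFun hφ x
  have hlap : ∀ x, netLap c φ x = (if x = y then 1 else 0) - if x = z then 1 else 0 := by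
    intro x
    by_cases hx : x = z
    · subst hx
      have h1 := sum_netLap hc φ
      rw [← Finset.add_sum_erase _ _ (Finset.mem_univ x),
        Finset.sum_congr rfl fun w hw => hoff w (Finset.ne_of_mem_erase hw)] at h1
      have h2 : ∑ w, (if w = y then (1 : ℝ) else 0) = 1 := by simp
      rw [← Finset.add_sum_erase _ _ (Finset.mem_univ x)] at h2
      rw [if_pos rfl]
      linarith
    · rw [hoff x hx, if_neg hx, sub_zero]
  have hpair : ∀ ψ : ι → ℝ, ∑ x, netLap c φ x * ψ x = ψ y - ψ z := by
    intro ψ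
    simp [hlap, sub_mul, Finset.sum_sub_distrib]
  have hE : netEnergy c φ = φ y := by rw [← hself, hpair, hz, sub_zero]
  have hE0 : 0 ≤ φ y := by
    rw [← hE, netEnergy]
    have : 0 ≤ ∑ x, ∑ y, c x y * (φ x - φ y) ^ 2 :=
      Finset.sum_nonneg fun x _ => Finset.sum_nonneg fun y _ => mul_nonneg (h0 x y) (sq_nonneg _)
    positivity
  have hyr : φ y ≤ r y := by
    rcases hE0.eq_or_lt with h | h
    · rw [← h]; exact hr0 y
    · have := hr y φ
      rw [hz, sub_zero, hE, sq] at this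
      exact le_of_mul_le_mul_right this h
  refine ⟨φ, hlap, fun x => ⟨?_, le_trans ?_ hyr⟩⟩
  -- The truncation has energy at most its difference between `y` and `z`, which vanishes. It is
  -- therefore constant and equal to its value at `z`. The upper bound by `φ y` is obtained in the
  -- same way.
  · have h1 : netEnergy c (fun x => min (φ x) 0) ≤ 0 := by
      refine (netEnergy_le_of_contraction hc h0 φ _ fun a b => ?_).trans ?_
      · rcases le_total (φ a) 0 with h | h <;> rcases le_total (φ b) 0 with h' | h' <;>
          simp only [min_eq_left, min_eq_right, h, h'] <;> nlinarith
      · rw [hpair]; simp [hz, hE0]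
    have h2 := hzero _ h1 x
    simp only [hz, min_self] at h2
    exact min_eq_right_iff.1 h2
  · have h1 : netEnergy c (fun x => max (φ x - φ y) 0) ≤ 0 := by
      refine (netEnergy_le_of_contraction hc h0 φ _ fun a b => ?_).trans ?_
      · rcases le_total (φ a - φ y) 0 with h | h <;> rcases le_total (φ b - φ y) 0 with h' | h' <;>
          simp only [max_eq_left, max_eq_right, h, h'] <;> nlinarith
      · rw [hpair]; simp [hz, hE0]
    have h2 := hzero _ h1 x
    simp only [hz, zero_sub, max_eq_right (neg_nonpos.2 hE0)] at h2
    exact sub_nonpos.1 (max_eq_right_iff.1 h2)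

/-- The Poisson equation on a finite network, with a bound of the solution by resistances. -/
lemma exists_poisson {c : ι → ι → ℝ} (hc : ∀ x y, c x y = c y x) (h0 : ∀ x y, 0 ≤ c x y)
    {r : ι → ℝ} {z : ι} (hr0 : ∀ y, 0 ≤ r y)
    (hr : ∀ y, ∀ φ : ι → ℝ, (φ y - φ z) ^ 2 ≤ r y * netEnergy c φ)
    {g : ι → ℝ} (hg : ∑ x, g x = 0) :
    ∃ h : ι → ℝ, (∀ x, netLap c h x = g x) ∧ ∀ x, |h x| ≤ ∑ y, |g y| * r y := by
  choose φ hφ hb using exists_green hc h0 hr0 hr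
  refine ⟨fun x => ∑ y, g y * φ y x, fun x => ?_, fun x => ?_⟩
  · have h1 : netLap c (fun x => ∑ y, g y * φ y x) x = ∑ y, g y * netLap c (φ y) x := by
      simp only [netLap, Finset.mul_sum, ← Finset.sum_sub_distrib]
      rw [Finset.sum_comm]
      exact Finset.sum_congr rfl fun _ _ => Finset.sum_congr rfl fun _ _ => by ring
    rw [h1]
    simp only [hφ, mul_sub, Finset.sum_sub_distrib, ← Finset.sum_mul, hg]
    simp
  · refine (Finset.abs_sum_le_sum_abs _ _).trans (Finset.sum_le_sum fun y _ => ?_)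
    rw [abs_mul, abs_of_nonneg (hb y x).1]
    exact mul_le_mul_of_nonneg_left (hb y x).2 (abs_nonneg _)

end Network

/-- The Dirichlet energy of a finite set `B` of vertices. -/
noncomputable def energyOn {ι : Type*} (B : Finset ι) (c : ι → ι → ℝ) (φ : ι → ℝ) : ℝ :=
  (1 / 2) * ∑ x ∈ B, ∑ y ∈ B, c x y * (φ x - φ y) ^ 2

/-- Edges leaving `B` are discarded, so the network is reflected at the boundary of `B`. -/
lemma exists_poisson_on {ι : Type*} [DecidableEq ι] (B : Finset ι) {c : ι → ι → ℝ}
    (hc : ∀ x y, c x y = c y x) (h0 : ∀ x y, 0 ≤ c x y) {r : ι → ℝ} {z : ι} (hz : z ∈ B)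
    (hr0 : ∀ y ∈ B, 0 ≤ r y)
    (hr : ∀ y ∈ B, ∀ φ : ι → ℝ, (φ y - φ z) ^ 2 ≤ r y * energyOn B c φ)
    {g : ι → ℝ} (hg : ∑ x ∈ B, g x = 0) :
    ∃ h : ι → ℝ, (∀ x ∈ B, ∑ y ∈ B, c x y * (h x - h y) = g x) ∧
      ∀ x ∈ B, |h x| ≤ ∑ y ∈ B, |g y| * r y := by
  have key := exists_poisson (ι := B) (c := fun x y => c x y) (fun x y => hc x y)
    (fun x y => h0 x y) (r := fun x => r x) (z := ⟨z, hz⟩) (fun y => hr0 y y.2)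
    (fun y φ => ?_) (g := fun x => g x) (by rw [← hg]; exact Finset.sum_coe_sort B g)
  · obtain ⟨h, h1, h2⟩ := key
    have hext : ∀ x : B, (if hx : (x : ι) ∈ B then h ⟨x, hx⟩ else 0) = h x := fun x => by simp
    refine ⟨fun x => if hx : x ∈ B then h ⟨x, hx⟩ else 0, fun x hx => ?_, fun x hx => ?_⟩
    · rw [← h1 ⟨x, hx⟩, netLap, ← Finset.sum_coe_sort B]
      refine Finset.sum_congr rfl fun y _ => ?_
      simp [hx]
    · simp only [hx, dif_pos]
      rw [← Finset.sum_coe_sort B (fun y => |g y| * r y)]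
      exact h2 ⟨x, hx⟩
  · have := hr y y.2 fun x => if hx : x ∈ B then φ ⟨x, hx⟩ else 0
    simp only [y.2, hz, dif_pos] at this
    refine this.trans_eq ?_
    congr 1
    rw [energyOn, netEnergy, ← Finset.sum_coe_sort B]
    congr 1
    refine Finset.sum_congr rfl fun a _ => ?_
    rw [← Finset.sum_coe_sort B]
    exact Finset.sum_congr rfl fun b _ => by simp

/-! ### Geometry of the lattice -/

lemma supNorm_le_iff {d : ℕ} {x : Site d} {k : ℕ} : supNorm x ≤ k ↔ ∀ i, (x i).natAbs ≤ k := by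
  simp [supNorm, Finset.sup_le_iff]

lemma natAbs_le_supNorm {d : ℕ} (x : Site d) (i : Fin d) : (x i).natAbs ≤ supNorm x :=
  supNorm_le_iff.1 le_rfl i

lemma exists_natAbs_eq_supNorm {d : ℕ} [NeZero d] (x : Site d) :
    ∃ i, (x i).natAbs = supNorm x := by
  obtain ⟨i, _, hi⟩ := Finset.exists_mem_eq_sup (Finset.univ : Finset (Fin d))
    Finset.univ_nonempty fun i => (x i).natAbs
  exact ⟨i, hi.symm⟩

lemma supNorm_zero {d : ℕ} : supNorm (0 : Site d) = 0 :=
  Nat.le_zero.1 (supNorm_le_iff.2 fun i => by simp)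

lemma mem_box {d : ℕ} [NeZero d] {x : Site d} {k : ℤ} : x ∈ box d k ↔ (supNorm x : ℤ) ≤ k := by
  have h1 : x ∈ box d k ↔ ∀ i, ((x i).natAbs : ℤ) ≤ k := by
    simp only [box, Fintype.mem_piFinset, Finset.mem_Icc]
    exact forall_congr' fun i => by omega
  rw [h1]
  constructor
  · intro h
    obtain ⟨i, hi⟩ := exists_natAbs_eq_supNorm x
    rw [← hi]
    exact h i
  · intro h i
    have := natAbs_le_supNorm x i
    omega

lemma mem_shell {d : ℕ} [NeZero d] {x : Site d} {k : ℤ} :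
    x ∈ shell d k ↔ (supNorm x : ℤ) = k := by
  simp only [shell, Finset.mem_sdiff, mem_box]
  omega

lemma card_box {d : ℕ} (k : ℕ) : (box d k).card = (2 * k + 1) ^ d := by
  simp only [box, Fintype.card_piFinset, Int.card_Icc, Finset.prod_const, Finset.card_univ,
    Fintype.card_fin]
  congr 1
  omega

lemma mem_neighbors {d : ℕ} {x y : Site d} :
    y ∈ neighbors x ↔ ∃ i, y = x + Pi.single i 1 ∨ y = x - Pi.single i 1 := by
  simp only [neighbors, Finset.mem_union, Finset.mem_image, Finset.mem_univ, true_and]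
  constructor
  · rintro (⟨i, rfl⟩ | ⟨i, rfl⟩)
    exacts [⟨i, Or.inl rfl⟩, ⟨i, Or.inr rfl⟩]
  · rintro ⟨i, rfl | rfl⟩
    exacts [Or.inl ⟨i, rfl⟩, Or.inr ⟨i, rfl⟩]

lemma mem_neighbors_comm {d : ℕ} {x y : Site d} : y ∈ neighbors x ↔ x ∈ neighbors y := by
  simp only [mem_neighbors]
  refine exists_congr fun i => ?_
  rw [or_comm]
  refine or_congr ?_ ?_
  · rw [eq_sub_iff_add_eq, eq_comm]
  · rw [eq_sub_iff_add_eq, eq_comm]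

lemma supNorm_le_of_mem_neighbors {d : ℕ} {x y : Site d} (h : y ∈ neighbors x) :
    supNorm y ≤ supNorm x + 1 := by
  refine supNorm_le_iff.2 fun j => ?_
  have hj := natAbs_le_supNorm x j
  obtain ⟨i, rfl | rfl⟩ := mem_neighbors.1 h <;> by_cases hij : j = i
  · subst hij; simp; omega
  · simp [hij]; omega
  · subst hij; simp; omega
  · simp [hij]; omega

lemma card_neighbors {d : ℕ} (x : Site d) : (neighbors x).card = 2 * d := by
  rw [neighbors, Finset.card_union_of_disjoint, Finset.card_image_of_injective,
    Finset.card_image_of_injective]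
  · simp; ring
  · intro i j h
    by_contra hij
    have := congrFun h i
    simp [hij] at this
  · intro i j h
    by_contra hij
    have := congrFun h i
    simp [hij] at this
  · rw [Finset.disjoint_left]
    intro y h1 h2
    simp only [Finset.mem_image, Finset.mem_univ, true_and] at h1 h2
    obtain ⟨i, rfl⟩ := h1
    obtain ⟨j, hj⟩ := h2
    have := congrFun hj i
    by_cases hij : i = j
    · subst hij; simp at this; omega
    · simp [hij] at this

lemma conductance_comm {d : ℕ} (V : Site d → ℝ) (x y : Site d) :
    conductance V x y = conductance V y x := by
  unfold conductance
  simp only [mem_neighbors_comm (x := x) (y := y)]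
  split_ifs
  · congr 1; ring
  · rfl

/-! ### Resistance bounds along lattice paths -/

lemma energyOn_nonneg {d : ℕ} (B : Finset (Site d)) (V : Site d → ℝ) (φ : Site d → ℝ) :
    0 ≤ energyOn B (conductance V) φ := by
  have : 0 ≤ ∑ x ∈ B, ∑ y ∈ B, conductance V x y * (φ x - φ y) ^ 2 :=
    Finset.sum_nonneg fun x _ => Finset.sum_nonneg fun y _ =>
      mul_nonneg (conductance_nonneg V x y) (sq_nonneg _)
  rw [energyOn]
  positivity

/-- A single edge contributes at most the whole energy, and its conductance is at least `e^{-w}`. -/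
lemma abs_sub_le_of_neighbors {d : ℕ} {B : Finset (Site d)} {V : Site d → ℝ} {w : ℝ}
    {x y : Site d} (hx : x ∈ B) (hy : y ∈ B) (hxy : y ∈ neighbors x) (hVx : V x ≤ w)
    (hVy : V y ≤ w) (φ : Site d → ℝ) :
    |φ x - φ y| ≤ √(2 * Real.exp w * energyOn B (conductance V) φ) := by
  refine Real.abs_le_sqrt ?_
  have hnn : ∀ a b, 0 ≤ conductance V a b * (φ a - φ b) ^ 2 := fun a b =>
    mul_nonneg (conductance_nonneg V a b) (sq_nonneg _)
  have h1 : conductance V x y * (φ x - φ y) ^ 2 ≤ 2 * energyOn B (conductance V) φ := by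
    have h2 : conductance V x y * (φ x - φ y) ^ 2
        ≤ ∑ b ∈ B, conductance V x b * (φ x - φ b) ^ 2 :=
      Finset.single_le_sum (f := fun b => conductance V x b * (φ x - φ b) ^ 2)
        (fun b _ => hnn x b) hy
    have h3 : ∑ b ∈ B, conductance V x b * (φ x - φ b) ^ 2
        ≤ ∑ a ∈ B, ∑ b ∈ B, conductance V a b * (φ a - φ b) ^ 2 :=
      Finset.single_le_sum (f := fun a => ∑ b ∈ B, conductance V a b * (φ a - φ b) ^ 2)
        (fun a _ => Finset.sum_nonneg fun b _ => hnn a b) hx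
    rw [energyOn]
    linarith
  have h4 : Real.exp (-w) ≤ conductance V x y := by
    rw [conductance, if_pos hxy]
    exact Real.exp_le_exp.2 (by linarith)
  calc (φ x - φ y) ^ 2 = Real.exp w * (Real.exp (-w) * (φ x - φ y) ^ 2) := by
        rw [← mul_assoc, ← Real.exp_add]; simp
    _ ≤ Real.exp w * (2 * energyOn B (conductance V) φ) := by
        refine mul_le_mul_of_nonneg_left ?_ (Real.exp_pos _).le
        exact (mul_le_mul_of_nonneg_right h4 (sq_nonneg _)).trans h1
    _ = _ := by ring

lemma update_succ_mem_neighbors {d : ℕ} (x : Site d) (i : Fin d) (t : ℤ) :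
    Function.update x i (t + 1) ∈ neighbors (Function.update x i t) := by
  refine mem_neighbors.2 ⟨i, Or.inl ?_⟩
  funext j
  by_cases hj : j = i
  · subst hj; simp
  · simp [hj]

lemma abs_sub_le_line {d : ℕ} {q : ℝ} {P : Site d → Prop} {φ : Site d → ℝ}
    (hq : ∀ x y, P x → P y → y ∈ neighbors x → |φ x - φ y| ≤ q) (x : Site d) (i : Fin d)
    (a b : ℤ) (hP : ∀ t, min a b ≤ t → t ≤ max a b → P (Function.update x i t)) :
    |φ (Function.update x i a) - φ (Function.update x i b)| ≤ |a - b| * q := by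
  have up : ∀ (k : ℕ) (a : ℤ), (∀ t, a ≤ t → t ≤ a + k → P (Function.update x i t)) →
      |φ (Function.update x i a) - φ (Function.update x i (a + k))| ≤ k * q := by
    intro k
    induction k with
    | zero => intro a _; simp
    | succ k ih =>
      intro a h
      have h1 := ih a fun t h1 h2 => h t h1 (by push_cast; omega)
      have h2 := hq _ _ (h (a + k) (by omega) (by push_cast; omega))
        (h (a + k + 1) (by omega) (by push_cast; omega)) (update_succ_mem_neighbors x i (a + k))
      have h3 := abs_sub_le (φ (Function.update x i a)) (φ (Function.update x i (a + k)))
        (φ (Function.update x i (a + k + 1)))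
      push_cast
      rw [← add_assoc]
      linarith
  rcases le_total a b with h | h
  · obtain ⟨k, rfl⟩ : ∃ k : ℕ, b = a + k := ⟨(b - a).toNat, by omega⟩
    have := up k a fun t h1 h2 => hP t (by omega) (by omega)
    simpa using this
  · obtain ⟨k, rfl⟩ : ∃ k : ℕ, a = b + k := ⟨(a - b).toNat, by omega⟩
    have := up k b fun t h1 h2 => hP t (by omega) (by omega)
    rw [abs_sub_comm]
    simpa using this

/-- A lattice path from `y` to the corner `(m, …, m)` that stays between the two hypercubes. -/
lemma abs_sub_corner_le {d : ℕ} (hd : 2 ≤ d) {q : ℝ} {P : Site d → Prop} {φ : Site d → ℝ}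
    (hq0 : 0 ≤ q) (hq : ∀ x y, P x → P y → y ∈ neighbors x → |φ x - φ y| ≤ q)
    {y : Site d} {m M : ℕ} (hyM : supNorm y ≤ M) (hmM : m ≤ M)
    (hP : ∀ x, min (supNorm y) m ≤ supNorm x → supNorm x ≤ max (supNorm y) m → P x) :
    |φ y - φ fun _ => (m : ℤ)| ≤ ((d + 2) * (2 * M) : ℕ) * q := by
  have : NeZero d := ⟨by omega⟩
  obtain ⟨i, hi⟩ := exists_natAbs_eq_supNorm y
  obtain ⟨i', hi'⟩ : ∃ i' : Fin d, i' ≠ i := by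
    have : Nontrivial (Fin d) := Fin.nontrivial_iff_two_le.2 hd
    exact exists_ne i
  set r := supNorm y with hr
  have hP' : ∀ x : Site d, (∀ j, (x j).natAbs ≤ max r m) → (∃ j, min r m ≤ (x j).natAbs) → P x :=
    fun x h1 ⟨j, hj⟩ => hP x (hj.trans (natAbs_le_supNorm x j)) (supNorm_le_iff.2 h1)
  have hyj : ∀ j, (y j).natAbs ≤ r := natAbs_le_supNorm y
  -- A coordinate of maximal modulus is pushed outwards, keeping its sign, up to modulus `max r m`;
  -- it does not move if `m ≤ r`.
  obtain ⟨w, hw1, hw2⟩ : ∃ w : ℤ, w.natAbs = max r m ∧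
      ∀ t, min (y i) w ≤ t → t ≤ max (y i) w → r ≤ t.natAbs ∧ t.natAbs ≤ max r m := by
    rcases le_total m r with h | h
    · exact ⟨y i, by omega, fun t h1 h2 => by omega⟩
    · rcases le_total 0 (y i) with h0 | h0
      · exact ⟨m, by omega, fun t h1 h2 => by omega⟩
      · exact ⟨-m, by omega, fun t h1 h2 => by omega⟩
  have hlen : ∀ a b : ℤ, a.natAbs ≤ max r m → b.natAbs ≤ max r m →
      ((|a - b| : ℤ) : ℝ) * q ≤ (2 * M : ℕ) * q := by
    intro a b ha hb
    refine mul_le_mul_of_nonneg_right ?_ hq0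
    exact_mod_cast (show |a - b| ≤ ((2 * M : ℕ) : ℤ) from abs_le.2 (by omega))
  set y1 := Function.update y i w with hy1
  have hy1j : ∀ j, (y1 j).natAbs ≤ max r m := by
    intro j
    by_cases hj : j = i
    · subst hj; simp [hy1, hw1]
    · simp only [hy1, Function.update_of_ne hj]; exact (hyj j).trans (le_max_left _ _)
  have hA : |φ y - φ y1| ≤ (2 * M : ℕ) * q := by
    have h := abs_sub_le_line hq y i (y i) w fun t h1 h2 => by
      obtain ⟨h3, h4⟩ := hw2 t h1 h2
      refine hP' _ (fun j => ?_) ⟨i, by simp; omega⟩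
      by_cases hj : j = i
      · subst hj; simpa using h4
      · simp only [Function.update_of_ne hj]; exact (hyj j).trans (le_max_left _ _)
    rw [Function.update_eq_self] at h
    exact_mod_cast h.trans (by exact_mod_cast hlen _ _ ((hyj i).trans (le_max_left _ _)) hw1.le)
  -- The other coordinates become `m` one at a time, while coordinate `i` holds the norm at `max r
  -- m`.
  let ys : Finset (Fin d) → Site d := fun s j => if j ∈ s then (m : ℤ) else y1 j
  have hB : ∀ s : Finset (Fin d), i ∉ s → |φ y1 - φ (ys s)| ≤ (s.card * (2 * M) : ℕ) * q := by
    intro s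
    induction s using Finset.induction_on with
    | empty => intro _; simp [ys]
    | insert j s hj ih =>
      intro his
      have hij : i ≠ j := fun h => his (by simp [h])
      have his' : i ∉ s := fun h => his (Finset.mem_insert_of_mem h)
      have e1 : Function.update (ys s) j (y1 j) = ys s := by
        rw [Function.update_eq_self_iff]; simp [ys, hj]
      have e2 : Function.update (ys s) j m = ys (insert j s) := by
        funext l
        by_cases hl : l = j
        · subst hl; simp [ys]
        · simp [ys, hl]
      have h := abs_sub_le_line hq (ys s) j (y1 j) m fun t h1 h2 => by
        have hj1 := hy1j j
        refine hP' _ (fun l => ?_) ⟨i, ?_⟩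
        · by_cases hl : l = j
          · subst hl; simp only [Function.update_self]; omega
          · simp only [Function.update_of_ne hl, ys]
            split_ifs
            · omega
            · exact hy1j l
        · simp only [Function.update_of_ne hij, ys, if_neg his', hy1, Function.update_self]
          omega
      rw [e1, e2] at h
      have h5 := h.trans (hlen _ _ (hy1j j) (by omega))
      have h6 := abs_sub_le (φ y1) (φ (ys s)) (φ (ys (insert j s)))
      have h7 := ih his'
      rw [Finset.card_insert_of_notMem hj]
      push_cast at h5 h6 h7 ⊢
      linarith
  have hBB := hB (Finset.univ.erase i) (by simp)
  have e1 : Function.update (fun _ => (m : ℤ)) i w = ys (Finset.univ.erase i) := by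
    funext l
    by_cases hl : l = i
    · subst hl; simp [ys, hy1]
    · simp [ys, hl]
  have e2 : Function.update (fun _ => (m : ℤ)) i (m : ℤ) = fun _ : Fin d => (m : ℤ) :=
    Function.update_eq_self_iff.2 rfl
  -- Coordinate `i` may now cross zero: the coordinate `i'`, which exists since `d ≥ 2`, keeps the
  -- norm at least `m`.
  have hC := abs_sub_le_line hq (fun _ => (m : ℤ)) i w m fun t h1 h2 => by
    refine hP' _ (fun l => ?_) ⟨i', ?_⟩
    · by_cases hl : l = i
      · subst hl; simp only [Function.update_self]; omega
      · simp only [Function.update_of_ne hl]; omega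
    · simp only [Function.update_of_ne hi']; omega
  rw [e1, e2] at hC
  have hC' := hC.trans (hlen _ _ hw1.le (by omega))
  have h8 := abs_sub_le (φ y) (φ y1) (φ (ys (Finset.univ.erase i)))
  have h9 := abs_sub_le (φ y) (φ (ys (Finset.univ.erase i))) (φ fun _ => (m : ℤ))
  have h10 : ((Finset.univ.erase i).card * (2 * M) : ℕ) * q ≤ (d * (2 * M) : ℕ) * q := by
    refine mul_le_mul_of_nonneg_right ?_ hq0
    have : (Finset.univ.erase i).card ≤ d := by
      simp
    exact_mod_cast Nat.mul_le_mul_right _ this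
  push_cast at *
  linarith

/-! ### Valleys and the Poisson equation in a valley. -/

/-- The potential `V` is close to the radial potential `s`, and on `[0, M]` the path `s` forms a
valley with bottom `m` and depth `Γ`, in which no inner barrier exceeds `Λ`. -/
structure IsValley {d : ℕ} (V : Site d → ℝ) (s : ℕ → ℝ) (m M : ℕ) (κ Λ Γ : ℝ) : Prop where
  lt : m < M
  pot : ∀ x, |V x - s (supNorm x)| ≤ κ
  step : ∀ j, |s (j + 1) - s j| ≤ κ
  bot : ∀ j ≤ M, s m ≤ s j
  up : ∀ i j, i ≤ j → j ≤ m → s j - s i ≤ Λ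
  down : ∀ i j, m ≤ i → i ≤ j → j ≤ M → s i - s j ≤ Λ
  gap : Γ ≤ s M - s m

section

variable {d : ℕ} {V : Site d → ℝ} {s : ℕ → ℝ} {m M : ℕ} {κ Λ Γ : ℝ}

lemma IsValley.nonneg (h : IsValley V s m M κ Λ Γ) : 0 ≤ κ := (abs_nonneg _).trans (h.step 0)

lemma IsValley.abs_sub_neighbor (h : IsValley V s m M κ Λ Γ) {x y : Site d}
    (hy : y ∈ neighbors x) : |V y - s (supNorm x)| ≤ 2 * κ := by
  have h1 := supNorm_le_of_mem_neighbors hy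
  have h2 := supNorm_le_of_mem_neighbors (mem_neighbors_comm.1 hy)
  have h3 := abs_le.1 (h.pot y)
  have h0 := h.nonneg
  rcases (by omega : supNorm y = supNorm x ∨ supNorm y = supNorm x + 1 ∨
    supNorm x = supNorm y + 1) with e | e | e
  · rw [e] at h3; exact abs_le.2 ⟨by linarith, by linarith⟩
  · have h4 := abs_le.1 (h.step (supNorm x))
    rw [e] at h3; exact abs_le.2 ⟨by linarith, by linarith⟩
  · have h4 := abs_le.1 (h.step (supNorm y))
    rw [e]; exact abs_le.2 ⟨by linarith, by linarith⟩

lemma IsValley.revMeasure_le (h : IsValley V s m M κ Λ Γ) (x : Site d) :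
    revMeasure V x ≤ 2 * d * Real.exp (-s (supNorm x) + 2 * κ) := by
  have h1 : ∀ y ∈ neighbors x, conductance V x y ≤ Real.exp (-s (supNorm x) + 2 * κ) := by
    intro y hy
    rw [conductance, if_pos hy]
    have h2 := abs_le.1 (h.abs_sub_neighbor hy)
    have h3 := abs_le.1 (h.pot x)
    have h0 := h.nonneg
    exact Real.exp_le_exp.2 (by linarith)
  have := Finset.sum_le_card_nsmul _ _ _ h1
  rw [card_neighbors, nsmul_eq_mul] at this
  exact_mod_cast this

lemma IsValley.le_revMeasure [NeZero d] (h : IsValley V s m M κ Λ Γ) (x : Site d) :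
    Real.exp (-s (supNorm x) - 2 * κ) ≤ revMeasure V x := by
  have hy : x + Pi.single (0 : Fin d) 1 ∈ neighbors x := mem_neighbors.2 ⟨0, Or.inl rfl⟩
  refine le_trans ?_ (Finset.single_le_sum (f := fun y => conductance V x y)
    (fun y _ => conductance_nonneg V x y) hy)
  simp only [conductance, if_pos hy]
  have h2 := abs_le.1 (h.abs_sub_neighbor hy)
  have h3 := abs_le.1 (h.pot x)
  have h0 := h.nonneg
  exact Real.exp_le_exp.2 (by linarith)

/-- Between the radius of `y` and `m`, moving towards `m`, the profile `s` climbs by at most `Λ`. -/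
lemma IsValley.pot_le (h : IsValley V s m M κ Λ Γ) {x y : Site d} (hy : supNorm y ≤ M)
    (h1 : min (supNorm y) m ≤ supNorm x) (h2 : supNorm x ≤ max (supNorm y) m) :
    V x ≤ s (supNorm y) + Λ + κ := by
  have h3 := (abs_le.1 (h.pot x)).2
  rcases le_total (supNorm y) m with h4 | h4
  · have := h.up (supNorm y) (supNorm x) (by omega) (by omega)
    linarith
  · have := h.down (supNorm x) (supNorm y) (by omega) (by omega) hy
    linarith

/-- A bound for the time that the chain needs to reach the bottom of a valley. -/
noncomputable def valleyTime (d M : ℕ) (κ Λ : ℝ) : ℝ :=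
  2 * ((2 * M + 1 : ℕ) ^ d * (4 * d * (((d + 2) * (2 * M) : ℕ) : ℝ) ^ 2 * Real.exp (Λ + 3 * κ)))

lemma valleyTime_nonneg (d M : ℕ) (κ Λ : ℝ) : 0 ≤ valleyTime d M κ Λ := by
  unfold valleyTime
  positivity

lemma sum_neighbors_subset {B : Finset (Site d)} {x : Site d} (hB : neighbors x ⊆ B)
    (F : Site d → ℝ) :
    ∑ y ∈ neighbors x, conductance V x y * F y = ∑ y ∈ B, conductance V x y * F y := by
  refine Finset.sum_subset hB fun y _ hy => ?_
  rw [conductance, if_neg hy, zero_mul]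

lemma neighbors_subset_box [NeZero d] {x : Site d} (hx : supNorm x < M) :
    neighbors x ⊆ box d M := by
  intro y hy
  have := supNorm_le_of_mem_neighbors hy
  exact mem_box.2 (by exact_mod_cast (by omega : supNorm y ≤ M))

/-- The resistance from `w` to the corner is of order `e^{s + Λ}` while the mass of `w` is of order
`e^{-s}`, with `s` taken at the radius of `w`. In the bound of the solution the two cancel, and only
`e^Λ` and powers of `M` remain. -/
lemma IsValley.exists_poisson [NeZero d] (h : IsValley V s m M κ Λ Γ) (hd : 2 ≤ d) {x : Site d}
    (hx : x ∈ box d M) {ρ : ℝ} (hρ : ρ = revMeasure V x / ∑ y ∈ box d M, revMeasure V y) :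
    ∃ g : Site d → ℝ, (∀ y, 0 ≤ g y ∧ g y ≤ valleyTime d M κ Λ) ∧
      ∀ y, supNorm y < M →
        ∑ w ∈ neighbors y, transProb V y w * g w = g y - ((if y = x then 1 else 0) - ρ) := by
  have hpos : ∀ y, 0 < revMeasure V y := revMeasure_pos V
  have hZ : 0 < ∑ y ∈ box d M, revMeasure V y := Finset.sum_pos (fun y _ => hpos y) ⟨x, hx⟩
  have hρ0 : 0 ≤ ρ := hρ ▸ div_nonneg (hpos x).le hZ.le
  have hρ1 : ρ ≤ 1 := by
    rw [hρ, div_le_one hZ]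
    exact Finset.single_le_sum (f := revMeasure V) (fun y _ => (hpos y).le) hx
  set N : ℕ := (d + 2) * (2 * M) with hN
  set f : Site d → ℝ := fun y => (if y = x then 1 else 0) - ρ with hf
  have hfabs : ∀ y, |f y| ≤ 1 := by
    intro y
    simp only [hf]
    split_ifs <;> exact abs_le.2 ⟨by linarith, by linarith⟩
  have hmem : ∀ y, y ∈ box d M ↔ supNorm y ≤ M := fun y => by rw [mem_box]; norm_cast
  -- `N` bounds the length of the path to the corner. Each edge costs the same square root, so
  -- squaring the sum gives `N ^ 2`.
  let r : Site d → ℝ := fun y => (N : ℝ) ^ 2 * (2 * Real.exp (s (supNorm y) + Λ + κ))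
  have hr : ∀ y ∈ box d M, ∀ φ : Site d → ℝ,
      (φ y - φ fun _ => (m : ℤ)) ^ 2 ≤ r y * energyOn (box d M) (conductance V) φ := by
    intro y hy φ
    have hyM := (hmem y).1 hy
    have h1 := abs_sub_corner_le hd (φ := φ)
      (P := fun x => x ∈ box d M ∧ V x ≤ s (supNorm y) + Λ + κ)
      (Real.sqrt_nonneg (2 * Real.exp (s (supNorm y) + Λ + κ) *
        energyOn (box d M) (conductance V) φ))
      (fun a b ha hb hab => abs_sub_le_of_neighbors ha.1 hb.1 hab ha.2 hb.2 φ)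
      hyM h.lt.le fun a h1 h2 =>
        ⟨(hmem a).2 (h2.trans (max_le hyM h.lt.le)), h.pot_le hyM h1 h2⟩
    have h2 := pow_le_pow_left₀ (abs_nonneg _) h1 2
    rw [sq_abs, mul_pow, Real.sq_sqrt (mul_nonneg (by positivity) (energyOn_nonneg _ _ _))] at h2
    refine h2.trans_eq ?_
    simp only [r, hN]
    ring
  have hcorner : (fun _ => (m : ℤ)) ∈ box d M :=
    (hmem _).2 (supNorm_le_iff.2 fun _ => by simpa using h.lt.le)
  have hsum : ∑ y ∈ box d M, revMeasure V y * f y = 0 := by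
    simp only [hf, mul_sub, Finset.sum_sub_distrib, mul_ite, mul_one, mul_zero,
      Finset.sum_ite_eq', hx, if_true, ← Finset.sum_mul, hρ]
    field_simp
    ring
  obtain ⟨g, hg1, hg2⟩ := exists_poisson_on (box d M) (conductance_comm V) (conductance_nonneg V)
    hcorner (r := r) (fun y _ => by positivity) hr hsum
  set T₀ : ℝ := (2 * M + 1 : ℕ) ^ d * (4 * d * (N : ℝ) ^ 2 * Real.exp (Λ + 3 * κ)) with hT₀
  have hT : valleyTime d M κ Λ = 2 * T₀ := rfl
  have hT0 : 0 ≤ T₀ := by positivity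
  have hgT : ∀ y ∈ box d M, |g y| ≤ T₀ := by
    intro y hy
    refine (hg2 y hy).trans ?_
    have h1 : ∀ w ∈ box d M, |revMeasure V w * f w| * r w
        ≤ 4 * d * (N : ℝ) ^ 2 * Real.exp (Λ + 3 * κ) := by
      intro w _
      rw [abs_mul, abs_of_pos (hpos w)]
      calc revMeasure V w * |f w| * r w
          ≤ (2 * d * Real.exp (-s (supNorm w) + 2 * κ)) * 1 * r w := by
            refine mul_le_mul_of_nonneg_right ?_ (by positivity)
            exact mul_le_mul (h.revMeasure_le w) (hfabs w) (abs_nonneg _) (by positivity)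
        _ = 4 * d * (N : ℝ) ^ 2 * (Real.exp (-s (supNorm w) + 2 * κ)
              * Real.exp (s (supNorm w) + Λ + κ)) := by simp only [r]; ring
        _ = _ := by rw [← Real.exp_add]; congr 2; ring
    have h2 := Finset.sum_le_card_nsmul _ _ _ h1
    rw [card_box, nsmul_eq_mul] at h2
    rw [hT₀]
    push_cast at h2 ⊢
    exact h2
  -- Adding the constant `T₀` makes the solution nonnegative; this accounts for the factor `2` in
  -- `valleyTime`.
  refine ⟨fun y => if y ∈ box d M then g y + T₀ else 0, fun y => ?_, fun y hy => ?_⟩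
  · simp only
    rw [hT]
    split_ifs with hy
    · have := abs_le.1 (hgT y hy)
      exact ⟨by linarith, by linarith⟩
    · exact ⟨le_rfl, by positivity⟩
  · have hyB : y ∈ box d M := (hmem y).2 hy.le
    have hsub := neighbors_subset_box hy
    beta_reduce
    rw [if_pos hyB]
    have h1 : ∑ w ∈ neighbors y, transProb V y w * (if w ∈ box d M then g w + T₀ else 0)
        = (∑ w ∈ neighbors y, conductance V y w * (g w + T₀)) / revMeasure V y := by
      rw [Finset.sum_div]
      refine Finset.sum_congr rfl fun w hw => ?_
      rw [if_pos (hsub hw), transProb]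
      ring
    have h2 : ∑ w ∈ neighbors y, conductance V y w * (g y - g w) = revMeasure V y * f y := by
      rw [sum_neighbors_subset hsub, hg1 y hyB]
    have h3 : ∑ w ∈ neighbors y, conductance V y w * (g w + T₀)
        = revMeasure V y * (g y + T₀) - revMeasure V y * f y := by
      rw [← h2, revMeasure, Finset.sum_mul, ← Finset.sum_sub_distrib]
      exact Finset.sum_congr rfl fun w _ => by ring
    rw [h1, h3]
    have := (hpos y).ne'
    field_simp
    rfl

/-! ### The exit from the box -/

/-- The probability that the chain leaves `B_{M-1}` within `n` steps. -/
noncomputable def exitProb (V : Site d → ℝ) (M : ℕ) : ℕ → Site d → ℝ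
  | 0, x => if supNorm x < M then 0 else 1
  | n + 1, x => if supNorm x < M then
      ∑ y ∈ neighbors x, transProb V x y * exitProb V M n y else 1

lemma transProb_nonneg [NeZero d] (V : Site d → ℝ) (x y : Site d) : 0 ≤ transProb V x y :=
  div_nonneg (conductance_nonneg V x y) (revMeasure_pos V x).le

lemma sum_transProb [NeZero d] (V : Site d → ℝ) (x : Site d) :
    ∑ y ∈ neighbors x, transProb V x y = 1 := by
  simp only [transProb]
  rw [← Finset.sum_div]
  exact div_self (revMeasure_pos V x).ne'

lemma sum_transProb_mul_le [NeZero d] {x : Site d} {F : Site d → ℝ} {a : ℝ}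
    (h : ∀ y ∈ neighbors x, F y ≤ a) : ∑ y ∈ neighbors x, transProb V x y * F y ≤ a := by
  calc ∑ y ∈ neighbors x, transProb V x y * F y ≤ ∑ y ∈ neighbors x, transProb V x y * a :=
        Finset.sum_le_sum fun y hy => mul_le_mul_of_nonneg_left (h y hy) (transProb_nonneg V x y)
    _ = a := by rw [← Finset.sum_mul, sum_transProb, one_mul]

lemma exitProb_nonneg [NeZero d] (n : ℕ) (x : Site d) : 0 ≤ exitProb V M n x := by
  induction n generalizing x with
  | zero => rw [exitProb]; split_ifs <;> norm_num
  | succ n ih =>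
    rw [exitProb]
    split_ifs
    · exact Finset.sum_nonneg fun y _ => mul_nonneg (transProb_nonneg V x y) (ih y)
    · norm_num

lemma exitProb_le_one [NeZero d] (n : ℕ) (x : Site d) : exitProb V M n x ≤ 1 := by
  induction n generalizing x with
  | zero => rw [exitProb]; split_ifs <;> norm_num
  | succ n ih =>
    rw [exitProb]
    split_ifs
    · exact sum_transProb_mul_le fun y _ => ih y
    · norm_num

lemma exitProb_of_le {n : ℕ} {x : Site d} (hx : M ≤ supNorm x) : exitProb V M n x = 1 := by
  cases n <;> rw [exitProb, if_neg (not_lt.2 hx)]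

/-- By reversibility one step of the chain does not increase the `π`-weighted sum over `B_M`, so
each unit of time adds at most the mass of the outer hypercube. -/
lemma sum_revMeasure_exitProb_le [NeZero d] (n : ℕ) :
    ∑ x ∈ box d ((M : ℤ) - 1), revMeasure V x * exitProb V M n x
      ≤ n * ∑ y ∈ shell d M, revMeasure V y := by
  have hmem : ∀ x, x ∈ box d ((M : ℤ) - 1) ↔ supNorm x < M := fun x => by rw [mem_box]; omega
  induction n with
  | zero =>
    simp only [Nat.cast_zero, zero_mul]
    refine (Finset.sum_eq_zero fun x hx => ?_).le
    rw [exitProb, if_pos ((hmem x).1 hx), mul_zero]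
  | succ n ih =>
    have h1 : ∀ x ∈ box d ((M : ℤ) - 1), revMeasure V x * exitProb V M (n + 1) x
        = ∑ y ∈ box d M, conductance V x y * exitProb V M n y := by
      intro x hx
      rw [exitProb, if_pos ((hmem x).1 hx), ← sum_neighbors_subset
        (neighbors_subset_box ((hmem x).1 hx)), Finset.mul_sum]
      refine Finset.sum_congr rfl fun y _ => ?_
      rw [transProb]
      have := (revMeasure_pos V x).ne'
      field_simp
    have h2 : ∀ y, ∑ x ∈ box d ((M : ℤ) - 1), conductance V x y ≤ revMeasure V y := by
      intro y
      calc ∑ x ∈ box d ((M : ℤ) - 1), conductance V x y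
          = ∑ x ∈ box d ((M : ℤ) - 1) with x ∈ neighbors y, conductance V y x := by
            rw [Finset.sum_filter]
            refine Finset.sum_congr rfl fun x _ => ?_
            rw [conductance_comm]
            split_ifs with h
            · rfl
            · rw [conductance, if_neg h]
        _ ≤ revMeasure V y := by
            refine Finset.sum_le_sum_of_subset_of_nonneg ?_ fun _ _ _ => conductance_nonneg V _ _
            exact fun x hx => (Finset.mem_filter.1 hx).2
    have hsplit : box d M = box d ((M : ℤ) - 1) ∪ shell d M := by
      ext x
      rw [Finset.mem_union, hmem, mem_box, mem_shell]
      omega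
    have hdisj : Disjoint (box d ((M : ℤ) - 1)) (shell d M) := by
      rw [Finset.disjoint_left]
      intro x h1 h2
      rw [hmem] at h1
      rw [mem_shell] at h2
      omega
    rw [Finset.sum_congr rfl h1, Finset.sum_comm]
    calc ∑ y ∈ box d M, ∑ x ∈ box d ((M : ℤ) - 1), conductance V x y * exitProb V M n y
        ≤ ∑ y ∈ box d M, revMeasure V y * exitProb V M n y := by
          refine Finset.sum_le_sum fun y _ => ?_
          rw [← Finset.sum_mul]
          exact mul_le_mul_of_nonneg_right (h2 y) (exitProb_nonneg n y)
      _ = ∑ y ∈ box d ((M : ℤ) - 1), revMeasure V y * exitProb V M n y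
            + ∑ y ∈ shell d M, revMeasure V y * exitProb V M n y := by
          rw [hsplit, Finset.sum_union hdisj]
      _ ≤ n * ∑ y ∈ shell d M, revMeasure V y + ∑ y ∈ shell d M, revMeasure V y := by
          refine add_le_add ih (Finset.sum_le_sum fun y _ => ?_)
          exact mul_le_of_le_one_right (revMeasure_pos V y).le (exitProb_le_one n y)
      _ = _ := by push_cast; ring

/-- The exit probability from the centre of a deep valley. -/
lemma IsValley.exitProb_le [NeZero d] (h : IsValley V s m M κ Λ Γ) (n : ℕ) :
    exitProb V M n 0 ≤ n * ((2 * M + 1 : ℕ) ^ d * (2 * d * Real.exp (4 * κ - Γ))) := by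
  obtain ⟨β, hβ⟩ : ∃ β : ℝ, β = n * ((2 * M + 1 : ℕ) ^ d * (2 * d * Real.exp (4 * κ - Γ))) := ⟨_, rfl⟩
  rw [← hβ]
  have hβ0 : 0 ≤ β := by rw [hβ]; positivity
  have hshell : ∑ y ∈ shell d M, revMeasure V y
      ≤ (2 * M + 1 : ℕ) ^ d * (2 * d * Real.exp (-s M + 2 * κ)) := by
    have h1 : ∀ y ∈ shell d M, revMeasure V y ≤ 2 * d * Real.exp (-s M + 2 * κ) := by
      intro y hy
      have := h.revMeasure_le y
      rwa [show supNorm y = M by exact_mod_cast mem_shell.1 hy] at this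
    refine (Finset.sum_le_card_nsmul _ _ _ h1).trans ?_
    rw [nsmul_eq_mul]
    refine mul_le_mul_of_nonneg_right ?_ (by positivity)
    have : (shell d M).card ≤ (2 * M + 1) ^ d := by
      rw [← card_box]
      exact Finset.card_le_card Finset.sdiff_subset
    exact_mod_cast this
  -- A single term of the weighted sum, divided by its mass, which is of order `e^{-s m}`.
  have hbot : ∀ j ≤ n, ∀ x, supNorm x = m → exitProb V M j x ≤ β := by
    intro j hj x hx
    have hxD : x ∈ box d ((M : ℤ) - 1) := by
      rw [mem_box, hx]; have := h.lt; omega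
    have h1 := (Finset.single_le_sum (f := fun x => revMeasure V x * exitProb V M j x)
      (fun y _ => mul_nonneg (revMeasure_pos V y).le (exitProb_nonneg j y)) hxD).trans
      (sum_revMeasure_exitProb_le j)
    have h2 := h.le_revMeasure x
    rw [hx] at h2
    have h3 : Real.exp (-s m - 2 * κ) * exitProb V M j x
        ≤ n * ((2 * M + 1 : ℕ) ^ d * (2 * d * Real.exp (-s M + 2 * κ))) := by
      refine (mul_le_mul_of_nonneg_right h2 (exitProb_nonneg j x)).trans (h1.trans ?_)
      exact mul_le_mul (Nat.cast_le.2 hj) hshell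
        (Finset.sum_nonneg fun y _ => (revMeasure_pos V y).le) (Nat.cast_nonneg n)
    have h5 := mul_le_mul_of_nonneg_left h3 (Real.exp_pos (s m + 2 * κ)).le
    rw [← mul_assoc, ← Real.exp_add, show s m + 2 * κ + (-s m - 2 * κ) = 0 by ring,
      Real.exp_zero, one_mul] at h5
    have h6 : Real.exp (s m + 2 * κ) * Real.exp (-s M + 2 * κ) ≤ Real.exp (4 * κ - Γ) := by
      rw [← Real.exp_add]
      have := h.gap
      exact Real.exp_le_exp.2 (by linarith)
    have h7 : ∀ a b e e' : ℝ, e * (n * (a * (b * e'))) = n * (a * (b * (e * e'))) := by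
      intro a b e e'; ring
    rw [h7] at h5
    refine h5.trans ?_
    rw [hβ]
    refine mul_le_mul_of_nonneg_left (mul_le_mul_of_nonneg_left
      (mul_le_mul_of_nonneg_left h6 ?_) ?_) ?_ <;> positivity
  -- Nearest-neighbour steps force a chain started in `B_m` to visit `C_m` before it exits.
  have hin : ∀ j ≤ n, ∀ x, supNorm x ≤ m → exitProb V M j x ≤ β := by
    intro j
    induction j with
    | zero =>
      intro _ x hx
      rw [exitProb, if_pos (hx.trans_lt h.lt)]
      exact hβ0
    | succ j ih =>
      intro hj x hx
      rcases hx.eq_or_lt with e | hlt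
      · exact hbot _ hj x e
      · rw [exitProb, if_pos (hlt.trans h.lt)]
        refine sum_transProb_mul_le fun y hy => ih (by omega) y ?_
        have := supNorm_le_of_mem_neighbors hy
        omega
  exact hin n le_rfl 0 (by rw [supNorm_zero]; omega)

/-! ### Concentration of the local time -/

lemma quenchedLaw_le_of_superharmonic_real [NeZero d] (V : Site d → ℝ) (z : Site d)
    (D : Set (Site d)) (f : Site d → ℝ) (G : ℕ → Site d → ℝ → ℝ) (hG0 : ∀ j x s, 0 ≤ G j x s)
    (hG : ∀ j, ∀ x ∉ D, ∀ s, 1 ≤ G j x s)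
    (hstep : ∀ j, ∀ x ∈ D, ∀ s,
      ∑ y ∈ neighbors x, transProb V x y * G j y (s + f x) ≤ G (j + 1) x s) (n : ℕ) :
    quenchedLaw V z {X | 1 ≤ G 0 (X n) (∑ i ∈ Finset.range n, f (X i)) ∨ ∃ i < n, X i ∉ D}
      ≤ ENNReal.ofReal (G n z 0) := by
  have := quenchedLaw_le_of_superharmonic V z D f (fun j x s => ENNReal.ofReal (G j x s))
    (fun j x hx s => by simpa using hG j x hx s) (fun j x hx s => ?_) n
  · simpa using this
  · rw [← Finset.sum_congr rfl fun y _ => ENNReal.ofReal_mul (transProb_nonneg V x y),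
      ← ENNReal.ofReal_sum_of_nonneg fun y _ => mul_nonneg (transProb_nonneg V x y) (hG0 _ _ _)]
    exact ENNReal.ofReal_le_ofReal (hstep j x hx s)

/-- Counting over times `1, …, n` and over `0, …, n - 1` differs by the two end terms only. -/
lemma abs_localTime_sub_le {d : ℕ} (X : ℕ → Site d) (x : Site d) (n : ℕ) :
    |localTime X x n - ∑ i ∈ Finset.range n, (if X i = x then (1 : ℝ) else 0)| ≤ 1 := by
  have h1 : localTime X x n = ∑ i ∈ Finset.range n, (if X (i + 1) = x then (1 : ℝ) else 0) := by
    rw [localTime, Finset.range_eq_Ico, Finset.sum_Ico_add' (fun k => if X k = x then (1 : ℝ) else 0)]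
    rfl
  rw [h1, ← Finset.sum_sub_distrib,
    Finset.sum_range_sub (fun i => if X i = x then (1 : ℝ) else 0)]
  split_ifs <;> norm_num

/-- In a valley, the local time of a site is close to its stationary value. -/
theorem IsValley.localTime_concentration [NeZero d] (h : IsValley V s m M κ Λ Γ) (hd : 2 ≤ d)
    {x : Site d} (hx : x ∈ box d M) {ρ : ℝ}
    (hρ : ρ = revMeasure V x / ∑ y ∈ box d M, revMeasure V y) {n : ℕ} {δ T : ℝ}
    (hT : valleyTime d M κ Λ ≤ T) (hT1 : T + 1 ≤ δ * ρ * n / 2) :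
    quenchedLaw V 0 {X | ¬ |localTime X x n / n - ρ| ≤ δ * ρ}
      ≤ ENNReal.ofReal (n * ((2 * M + 1 : ℕ) ^ d * (2 * d * Real.exp (4 * κ - Γ)))
          + (2 * T ^ 2 + 2 * T * ρ * n) / (δ * ρ * n / 2) ^ 2) := by
  obtain ⟨g, hg, hgP⟩ := h.exists_poisson hd hx hρ
  have hT0 : 0 ≤ T := (valleyTime_nonneg d M κ Λ).trans hT
  have hρ0 : 0 ≤ ρ := hρ ▸ div_nonneg (revMeasure_pos V x).le
    (Finset.sum_nonneg fun y _ => (revMeasure_pos V y).le)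
  set lam : ℝ := δ * ρ * n / 2 with hlam
  have hlam0 : 0 < lam := by linarith
  have hn : (0 : ℝ) < n := by
    rcases (Nat.cast_nonneg (α := ℝ) n).eq_or_lt with e | e
    · rw [hlam, ← e] at hlam0; simp at hlam0
    · exact e
  set f : Site d → ℝ := fun y => (if y = x then 1 else 0) - ρ with hf
  -- `K` dominates `(t + g)²`, since `0 ≤ g ≤ T`. One step lowers it by `f² + 2 (T - g) (f + ρ) + 2
  -- ρ g`, which is nonnegative because `f ≥ -ρ`.
  let K : ℕ → Site d → ℝ → ℝ := fun j y t =>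
    t ^ 2 + 2 * t * g y + 2 * T * g y + 2 * T * ρ * j
  have hg' : ∀ y, 0 ≤ g y ∧ g y ≤ T := fun y => ⟨(hg y).1, (hg y).2.trans hT⟩
  have hKsq : ∀ j y t, (t + g y) ^ 2 ≤ K j y t := by
    intro j y t
    obtain ⟨h1, h2⟩ := hg' y
    have h3 : 0 ≤ 2 * T * ρ * j := by positivity
    have h4 : 0 ≤ g y * (T - g y) := mul_nonneg h1 (by linarith)
    have h5 : 0 ≤ g y * T := mul_nonneg h1 hT0
    simp only [K]
    nlinarith
  have hK0 : ∀ j y t, 0 ≤ K j y t := fun j y t => (sq_nonneg _).trans (hKsq j y t)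
  -- The first term handles trajectories that leave the box, the second is Chebyshev's bound for the
  -- rest.
  let G : ℕ → Site d → ℝ → ℝ := fun j y t => exitProb V M j y + K j y t / lam ^ 2
  have key := quenchedLaw_le_of_superharmonic_real V 0 {y | supNorm y < M} f G
    (fun j y t => add_nonneg (exitProb_nonneg j y) (div_nonneg (hK0 j y t) (sq_nonneg _)))
    (fun j y hy t => ?_) (fun j y hy t => ?_) n
  · refine (measure_mono ?_).trans (key.trans (ENNReal.ofReal_le_ofReal ?_))
    · intro X hX
      by_contra hcon
      simp only [Set.mem_ofPred_eq, not_or, not_exists, not_and, not_not, not_le] at hX hcon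
      obtain ⟨h1, h2⟩ := hcon
      have h3 : K 0 (X n) (∑ i ∈ Finset.range n, f (X i)) < lam ^ 2 := by
        have := exitProb_nonneg (V := V) (M := M) 0 (X n)
        have h4 : K 0 (X n) (∑ i ∈ Finset.range n, f (X i)) / lam ^ 2 < 1 := by
          simp only [G] at h1; linarith
        rwa [div_lt_one (by positivity)] at h4
      have h5 := abs_lt_of_sq_lt_sq ((hKsq _ _ _).trans_lt h3) hlam0.le
      have h6 := abs_lt.1 h5
      have h7 := abs_le.1 (abs_localTime_sub_le X x n)
      have h8 : ∑ i ∈ Finset.range n, f (X i)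
          = ∑ i ∈ Finset.range n, (if X i = x then (1 : ℝ) else 0) - n * ρ := by
        simp [hf, Finset.sum_sub_distrib]
      obtain ⟨h9, h10⟩ := hg' (X n)
      rw [h8] at h6
      -- One `lam` comes from the martingale; the other absorbs `g ≤ T` and the index shift, as `T +
      -- 1 ≤ lam`.
      have h11 : |localTime X x n - n * ρ| ≤ 2 * lam := abs_le.2 ⟨by linarith, by linarith⟩
      have h12 : localTime X x n / n - ρ = (localTime X x n - n * ρ) / n := by
        field_simp
      rw [h12, abs_div, abs_of_pos hn, lt_div_iff₀ hn] at hX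
      rw [hlam] at h11
      linarith
    · simp only [G, K]
      have h1 := h.exitProb_le n
      have h2 := (hg' 0).2
      refine add_le_add h1 (div_le_div_of_nonneg_right ?_ (sq_nonneg _))
      nlinarith
  · have h1 : M ≤ supNorm y := not_lt.1 hy
    simp only [G, exitProb_of_le h1]
    have : 0 ≤ K j y t / lam ^ 2 := div_nonneg (hK0 j y t) (sq_nonneg _)
    linarith
  · have hyM : supNorm y < M := hy
    have h1 : ∑ w ∈ neighbors y, transProb V y w * G j w (t + f y)
        = ∑ w ∈ neighbors y, transProb V y w * exitProb V M j w
          + ((t + f y) ^ 2 + 2 * T * ρ * j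
            + 2 * (t + f y + T) * ∑ w ∈ neighbors y, transProb V y w * g w) / lam ^ 2 := by
      have h2 : ∀ w, transProb V y w * G j w (t + f y)
          = transProb V y w * exitProb V M j w
            + (transProb V y w * (((t + f y) ^ 2 + 2 * T * ρ * j) / lam ^ 2)
            + transProb V y w * g w * (2 * (t + f y + T) / lam ^ 2)) := by
        intro w
        simp only [G, K]
        ring
      simp only [h2, Finset.sum_add_distrib, ← Finset.sum_mul, sum_transProb]
      ring
    rw [h1, hgP y hyM]
    simp only [G, K]
    rw [exitProb, if_pos hyM]
    refine add_le_add le_rfl (div_le_div_of_nonneg_right ?_ (sq_nonneg _))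
    change (t + f y) ^ 2 + 2 * T * ρ * j + 2 * (t + f y + T) * (g y - f y) ≤ _
    have h3 : -ρ ≤ f y := by
      simp only [hf]; split_ifs <;> linarith
    obtain ⟨h4, h5⟩ := hg' y
    push_cast
    nlinarith [mul_nonneg (sub_nonneg.2 h5) (by linarith : 0 ≤ f y + ρ), mul_nonneg hρ0 h4,
      sq_nonneg (f y)]

end

/-! ### Processes driven by i.i.d. increments -/

/-- The process that starts from `s₀` and is updated by the increments `η_1, η_2, …`. -/
def drivenBy {σ : Type*} (upd : σ → ℝ → σ) (s₀ : σ) (η : ℤ → ℝ) : ℕ → σ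
  | 0 => s₀
  | k + 1 => upd (drivenBy upd s₀ η k) (η (k + 1))

lemma drivenBy_congr {σ : Type*} {upd : σ → ℝ → σ} {s₀ : σ} {η η' : ℤ → ℝ} {k : ℕ}
    (h : ∀ i ∈ Finset.Icc (1 : ℤ) k, η i = η' i) :
    drivenBy upd s₀ η k = drivenBy upd s₀ η' k := by
  induction k with
  | zero => rfl
  | succ k ih =>
    rw [drivenBy, drivenBy, h (k + 1) (Finset.mem_Icc.2 ⟨by omega, by push_cast; omega⟩),
      ih fun i hi => h i (Finset.Icc_subset_Icc_right (by push_cast; omega) hi)]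

lemma measurable_drivenBy {σ : Type*} [MeasurableSpace σ] {upd : σ → ℝ → σ}
    (hupd : Measurable (Function.uncurry upd)) (s₀ : σ) (k : ℕ) :
    Measurable fun η : ℤ → ℝ => drivenBy upd s₀ η k := by
  induction k with
  | zero => exact measurable_const
  | succ k ih => exact hupd.comp (ih.prodMk (measurable_pi_apply _))

section

variable (μη : Measure ℝ) [IsProbabilityMeasure μη]

/-- The state at time `k` depends on `η_1, …, η_k` only, hence is independent of `η_{k+1}`. -/
lemma lintegral_drivenBy_succ {σ : Type*} [MeasurableSpace σ] {upd : σ → ℝ → σ}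
    (hupd : Measurable (Function.uncurry upd)) (s₀ : σ) (k : ℕ) {v : σ → ENNReal}
    (hv : Measurable v) :
    ∫⁻ η, v (drivenBy upd s₀ η (k + 1)) ∂(Measure.infinitePi fun _ : ℤ => μη)
      = ∫⁻ η, ∫⁻ t, v (upd (drivenBy upd s₀ η k) t) ∂μη
          ∂(Measure.infinitePi fun _ : ℤ => μη) := by
  set μ := Measure.infinitePi fun _ : ℤ => μη with hμ
  have hind : iIndepFun (fun (i : ℤ) (η : ℤ → ℝ) => η i) μ :=
    iIndepFun_infinitePi (X := fun _ t => t) fun _ => measurable_id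
  have h1 := hind.indepFun_finset (Finset.Icc 1 (k : ℤ)) {(k : ℤ) + 1}
    (by simp) fun i => measurable_pi_apply i
  let ext : (Finset.Icc 1 (k : ℤ) → ℝ) → ℤ → ℝ := fun h i => if hi : i ∈ Finset.Icc 1 (k : ℤ)
    then h ⟨i, hi⟩ else 0
  have hext : Measurable ext := by
    refine measurable_pi_lambda _ fun i => ?_
    by_cases hi : i ∈ Finset.Icc 1 (k : ℤ)
    · simp only [ext, hi, dif_pos]; exact measurable_pi_apply _
    · simp only [ext, hi, dif_neg, not_false_eq_true]; exact measurable_const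
  have hst := measurable_drivenBy hupd s₀ k
  have hlast : Measurable fun h : ({(k : ℤ) + 1} : Finset ℤ) → ℝ =>
      h ⟨(k : ℤ) + 1, Finset.mem_singleton_self _⟩ := by fun_prop
  have h2 := h1.comp (φ := fun h => drivenBy upd s₀ (ext h) k) (hst.comp hext) hlast
  have h3 : (fun h => drivenBy upd s₀ (ext h) k) ∘
      (fun (η : ℤ → ℝ) (i : Finset.Icc 1 (k : ℤ)) => η i) = fun η => drivenBy upd s₀ η k := by
    funext η
    exact drivenBy_congr fun i hi => by simp only [ext, hi, dif_pos]
  rw [h3] at h2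
  have h4 := h2.map_prod_eq_prod_map_map hst.aemeasurable
    (Measurable.aemeasurable (by fun_prop))
  have h5 : μ.map (fun η : ℤ → ℝ => η ((k : ℤ) + 1)) = μη :=
    Measure.infinitePi_map_eval (fun _ : ℤ => μη) ((k : ℤ) + 1)
  have h6 : ((fun h : ({(k : ℤ) + 1} : Finset ℤ) → ℝ => h ⟨(k : ℤ) + 1, Finset.mem_singleton_self _⟩) ∘
      fun (η : ℤ → ℝ) (i : ({(k : ℤ) + 1} : Finset ℤ)) => η i) = fun η => η ((k : ℤ) + 1) := rfl
  rw [h6, h5] at h4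
  have hvm : Measurable fun p : σ × ℝ => v (upd p.1 p.2) := hv.comp hupd
  calc ∫⁻ η, v (drivenBy upd s₀ η (k + 1)) ∂μ
      = ∫⁻ p, v (upd p.1 p.2)
          ∂(μ.map fun η => (drivenBy upd s₀ η k, η ((k : ℤ) + 1))) := by
        rw [lintegral_map hvm (hst.prodMk (measurable_pi_apply _))]
        rfl
    _ = ∫⁻ s, ∫⁻ t, v (upd s t) ∂μη ∂(μ.map fun η => drivenBy upd s₀ η k) := by
        rw [h4, lintegral_prod _ hvm.aemeasurable]
    _ = _ := by
        rw [lintegral_map (Measurable.lintegral_prod_right hvm) hst]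

/-- A supermartingale bound for a process driven by i.i.d. increments. -/
theorem measure_drivenBy_le {σ : Type*} [MeasurableSpace σ] {upd : σ → ℝ → σ}
    (hupd : Measurable (Function.uncurry upd)) (s₀ : σ) {v : ℕ → σ → ℝ}
    (hv : ∀ k, Measurable (v k))
    (hstep : ∀ k s, ∫⁻ t, ENNReal.ofReal (v (k + 1) (upd s t)) ∂μη ≤ ENNReal.ofReal (v k s))
    (K : ℕ) :
    (Measure.infinitePi fun _ : ℤ => μη) {η | 1 ≤ v K (drivenBy upd s₀ η K)}
      ≤ ENNReal.ofReal (v 0 s₀) := by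
  set μ := Measure.infinitePi fun _ : ℤ => μη with hμ
  have h1 : ∀ k, ∫⁻ η, ENNReal.ofReal (v k (drivenBy upd s₀ η k)) ∂μ
      ≤ ENNReal.ofReal (v 0 s₀) := by
    intro k
    induction k with
    | zero => simp [drivenBy]
    | succ k ih =>
      rw [lintegral_drivenBy_succ μη hupd s₀ k (hv (k + 1)).ennreal_ofReal]
      exact (lintegral_mono fun η => hstep k _).trans ih
  have h2 := mul_meas_ge_le_lintegral (μ := μ)
    (((hv K).comp (measurable_drivenBy hupd s₀ K)).ennreal_ofReal) 1
  rw [one_mul] at h2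
  refine le_trans (measure_mono fun η hη => ?_) (h2.trans (h1 K))
  simpa using hη

/-- A centred, bounded step law. -/
structure IsStepLaw (c : ℝ) : Prop where
  nonneg : 0 ≤ c
  bound : ∀ᵐ t ∂μη, |t| ≤ c
  mean : ∫ t, t ∂μη = 0

variable {μη} {c : ℝ}

lemma IsStepLaw.integrable (h : IsStepLaw μη c) : Integrable (fun t : ℝ => t) μη :=
  Integrable.of_bound measurable_id.aestronglyMeasurable c
    (by simpa [Real.norm_eq_abs] using h.bound)

lemma IsStepLaw.integrable_sq (h : IsStepLaw μη c) : Integrable (fun t : ℝ => t ^ 2) μη := by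
  refine Integrable.of_bound (by fun_prop) (c ^ 2) ?_
  filter_upwards [h.bound] with t ht
  rw [Real.norm_eq_abs, abs_pow]
  exact pow_le_pow_left₀ (abs_nonneg _) ht 2

/-- The linear term of a quadratic majorant integrates to zero; this verifies the supermartingale
property in each of the bounds below. -/
lemma IsStepLaw.lintegral_le (h : IsStepLaw μη c) {F : ℝ → ℝ} {p q r : ℝ}
    (hF : ∀ t, |t| ≤ c → F t ≤ p + q * t + r * t ^ 2 ∧ 0 ≤ p + q * t + r * t ^ 2) :
    ∫⁻ t, ENNReal.ofReal (F t) ∂μη ≤ ENNReal.ofReal (p + r * ∫ t, t ^ 2 ∂μη) := by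
  have hi' : Integrable (fun t => p + q * t) μη :=
    (integrable_const p).add (h.integrable.const_mul q)
  have hi : Integrable (fun t => p + q * t + r * t ^ 2) μη :=
    hi'.add (h.integrable_sq.const_mul r)
  calc ∫⁻ t, ENNReal.ofReal (F t) ∂μη
      ≤ ∫⁻ t, ENNReal.ofReal (p + q * t + r * t ^ 2) ∂μη := by
        refine lintegral_mono_ae ?_
        filter_upwards [h.bound] with t ht
        exact ENNReal.ofReal_le_ofReal (hF t ht).1
    _ = ENNReal.ofReal (∫ t, (p + q * t + r * t ^ 2) ∂μη) := by
        rw [ofReal_integral_eq_lintegral_ofReal hi]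
        filter_upwards [h.bound] with t ht using (hF t ht).2
    _ = _ := by
        rw [integral_add hi' (h.integrable_sq.const_mul r), integral_add (integrable_const p)
          (h.integrable.const_mul q), integral_const_mul, integral_const_mul, h.mean]
        simp

/-! ### The walk stopped on leaving an interval -/

/-- One step of the walk stopped on leaving `(-a, u)`. -/
noncomputable def stopStep (a u r t : ℝ) : ℝ := if -a < r ∧ r < u then r + t else r

lemma measurable_stopStep (a u : ℝ) : Measurable (Function.uncurry (stopStep a u)) := by
  refine Measurable.ite ?_ (by fun_prop) (by fun_prop)
  exact (measurableSet_lt measurable_const measurable_fst).inter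
    (measurableSet_lt measurable_fst measurable_const)

/-- Gambler's ruin with overshoot at most `c`: the linear function vanishing at `-a - c`, cut to
zero below `-a`, is a supermartingale. -/
lemma IsStepLaw.stop_top_le (h : IsStepLaw μη c) {a u : ℝ} (ha : 0 < a) (hu : 0 < u) (K : ℕ) :
    (Measure.infinitePi fun _ : ℤ => μη) {η | u ≤ drivenBy (stopStep a u) 0 η K}
      ≤ ENNReal.ofReal ((a + c) / (a + u)) := by
  have hc := h.nonneg
  have hau : 0 < a + u := by linarith
  let v : ℕ → ℝ → ℝ := fun _ r => if r ≤ -a then 0 else (r + a + c) / (a + u)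
  have key := measure_drivenBy_le μη (measurable_stopStep a u) 0 (v := v)
    (fun k => Measurable.ite (measurableSet_le measurable_id measurable_const) (by fun_prop)
      (by fun_prop)) (fun k r => ?_) K
  · refine (measure_mono fun η hη => ?_).trans (key.trans_eq ?_)
    · have h1 : u ≤ drivenBy (stopStep a u) 0 η K := hη
      simp only [Set.mem_ofPred_eq, v]
      rw [if_neg (by linarith), one_le_div hau]
      linarith
    · simp only [v]
      rw [if_neg (by linarith), zero_add]
  · by_cases hr : -a < r ∧ r < u
    · have h1 := h.lintegral_le (F := fun t => v (k + 1) (stopStep a u r t))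
        (p := (r + a + c) / (a + u)) (q := 1 / (a + u)) (r := 0) fun t ht => by
          have ht' := abs_le.1 ht
          have h2 : (r + a + c) / (a + u) + 1 / (a + u) * t + 0 * t ^ 2
              = (r + t + a + c) / (a + u) := by ring
          have h3 : 0 ≤ (r + t + a + c) / (a + u) := div_nonneg (by linarith) hau.le
          rw [h2]
          refine ⟨?_, h3⟩
          simp only [v, stopStep, if_pos hr]
          split_ifs
          · exact h3
          · exact le_rfl
      refine h1.trans_eq ?_
      simp only [v]
      rw [if_neg (not_le.2 hr.1), zero_mul, add_zero]
    · simp only [stopStep, if_neg hr, lintegral_const, measure_univ, mul_one]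
      exact le_rfl

lemma IsStepLaw.stop_bot_le (h : IsStepLaw μη c) {a u : ℝ} (ha : 0 < a) (hu : 0 < u) (K : ℕ) :
    (Measure.infinitePi fun _ : ℤ => μη) {η | drivenBy (stopStep a u) 0 η K ≤ -a}
      ≤ ENNReal.ofReal ((u + c) / (a + u)) := by
  have hc := h.nonneg
  have hau : 0 < a + u := by linarith
  let v : ℕ → ℝ → ℝ := fun _ r => if u ≤ r then 0 else (u + c - r) / (a + u)
  have key := measure_drivenBy_le μη (measurable_stopStep a u) 0 (v := v)
    (fun k => Measurable.ite (measurableSet_le measurable_const measurable_id) (by fun_prop)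
      (by fun_prop)) (fun k r => ?_) K
  · refine (measure_mono fun η hη => ?_).trans (key.trans_eq ?_)
    · have h1 : drivenBy (stopStep a u) 0 η K ≤ -a := hη
      simp only [Set.mem_ofPred_eq, v]
      rw [if_neg (by linarith), one_le_div hau]
      linarith
    · simp only [v]
      rw [if_neg (by linarith), sub_zero]
  · by_cases hr : -a < r ∧ r < u
    · have h1 := h.lintegral_le (F := fun t => v (k + 1) (stopStep a u r t))
        (p := (u + c - r) / (a + u)) (q := -1 / (a + u)) (r := 0) fun t ht => by
          have ht' := abs_le.1 ht
          have h2 : (u + c - r) / (a + u) + -1 / (a + u) * t + 0 * t ^ 2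
              = (u + c - (r + t)) / (a + u) := by ring
          have h3 : 0 ≤ (u + c - (r + t)) / (a + u) := div_nonneg (by linarith) hau.le
          rw [h2]
          refine ⟨?_, h3⟩
          simp only [v, stopStep, if_pos hr]
          split_ifs
          · exact h3
          · exact le_rfl
      refine h1.trans_eq ?_
      simp only [v]
      rw [if_neg (not_le.2 hr.2), zero_mul, add_zero]
    · simp only [stopStep, if_neg hr, lintegral_const, measure_univ, mul_one]
      exact le_rfl

/-- The martingale `r² - σ² k` bounds the exit time; `w` leaves room for an overshoot, which keeps
the function nonnegative. -/
lemma IsStepLaw.stop_time_le (h : IsStepLaw μη c) {a u w : ℝ} (haw : a + c ≤ w)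
    (huw : u + c ≤ w) (ha : 0 < a) (hu : 0 < u) (hv : 0 < ∫ t, t ^ 2 ∂μη) {K : ℕ} (hK : 0 < K) :
    (Measure.infinitePi fun _ : ℤ => μη)
        {η | -a < drivenBy (stopStep a u) 0 η K ∧ drivenBy (stopStep a u) 0 η K < u}
      ≤ ENNReal.ofReal (w ^ 2 / ((∫ t, t ^ 2 ∂μη) * K)) := by
  have hc := h.nonneg
  set σ2 := ∫ t, t ^ 2 ∂μη with hσ2
  have hK' : (0 : ℝ) < K := Nat.cast_pos.2 hK
  let v : ℕ → ℝ → ℝ := fun k r =>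
    if -a < r ∧ r < u then ((w ^ 2 - r ^ 2) / σ2 + k) / K else 0
  have hnn : ∀ (k : ℕ) (r : ℝ), |r| ≤ w → 0 ≤ ((w ^ 2 - r ^ 2) / σ2 + k) / K := by
    intro k r hr
    have h1 : r ^ 2 ≤ w ^ 2 := sq_le_sq' (by linarith [abs_le.1 hr]) (abs_le.1 hr).2
    have h2 : 0 ≤ (w ^ 2 - r ^ 2) / σ2 := div_nonneg (by linarith) hv.le
    positivity
  have key := measure_drivenBy_le μη (measurable_stopStep a u) 0 (v := v)
    (fun k => Measurable.ite ((measurableSet_lt measurable_const measurable_id).inter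
      (measurableSet_lt measurable_id measurable_const)) (by fun_prop) (by fun_prop))
    (fun k r => ?_) K
  · refine (measure_mono fun η hη => ?_).trans (key.trans_eq ?_)
    · have h1 : -a < drivenBy (stopStep a u) 0 η K ∧ drivenBy (stopStep a u) 0 η K < u := hη
      simp only [Set.mem_ofPred_eq, v]
      rw [if_pos h1, one_le_div hK']
      have h2 : (drivenBy (stopStep a u) 0 η K) ^ 2 ≤ w ^ 2 :=
        sq_le_sq' (by linarith) (by linarith)
      have h3 : 0 ≤ (w ^ 2 - (drivenBy (stopStep a u) 0 η K) ^ 2) / σ2 :=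
        div_nonneg (by linarith) hv.le
      linarith
    · simp only [v]
      rw [if_pos ⟨by linarith, hu⟩]
      congr 1
      simp only [ne_eq, OfNat.ofNat_ne_zero, not_false_eq_true, zero_pow, sub_zero,
        Nat.cast_zero, add_zero]
      rw [div_div]
  · by_cases hr : -a < r ∧ r < u
    · have h1 := h.lintegral_le (F := fun t => v (k + 1) (stopStep a u r t))
        (p := ((w ^ 2 - r ^ 2) / σ2 + (k + 1)) / K) (q := -2 * r / (σ2 * K))
        (r := -1 / (σ2 * K)) fun t ht => by
          have ht' := abs_le.1 ht
          have h2 : ((w ^ 2 - r ^ 2) / σ2 + (k + 1)) / K + -2 * r / (σ2 * K) * t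
              + -1 / (σ2 * K) * t ^ 2 = ((w ^ 2 - (r + t) ^ 2) / σ2 + (k + 1 : ℕ)) / K := by
            push_cast; field_simp; ring
          have h3 := hnn (k + 1) (r + t) (abs_le.2 ⟨by linarith, by linarith⟩)
          rw [h2]
          refine ⟨?_, h3⟩
          simp only [v, stopStep, if_pos hr]
          split_ifs
          · exact le_rfl
          · exact h3
      refine h1.trans_eq ?_
      simp only [v]
      rw [if_pos hr]
      congr 1
      field_simp
      ring
    · simp only [v, stopStep, if_neg hr]
      simp

/-! ### The reflected walk -/

/-- One step of the reflected walk. The flag is raised at the first passage above `l`; afterwards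
the walk is stopped on leaving `(b, u)`. -/
noncomputable def reflStep (l b u : ℝ) (s : ℝ × Bool) (t : ℝ) : ℝ × Bool :=
  if s.2 = false then (max (s.1 + t) 0, if l ≤ max (s.1 + t) 0 then true else false)
  else if b < s.1 ∧ s.1 < u then (max (s.1 + t) 0, true) else s

lemma measurable_reflStep (l b u : ℝ) : Measurable (Function.uncurry (reflStep l b u)) := by
  have h1 : Measurable fun p : (ℝ × Bool) × ℝ => max (p.1.1 + p.2) 0 := by fun_prop
  refine Measurable.ite ?_ (h1.prodMk ?_) (Measurable.ite ?_ (h1.prodMk measurable_const)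
    measurable_fst)
  · exact (measurable_snd.comp measurable_fst) (MeasurableSet.singleton false)
  · exact Measurable.ite (measurableSet_le measurable_const h1) measurable_const measurable_const
  · have h2 : Measurable fun p : (ℝ × Bool) × ℝ => p.1.1 := by fun_prop
    exact (measurableSet_lt measurable_const h2).inter (measurableSet_lt h2 measurable_const)

/-- Once the flag is raised at height at least `u - b`, this is gambler's ruin between `b` and `u`.
Reflection plays no role there, because a step from above `b ≥ c` stays nonnegative. -/
lemma IsStepLaw.refl_le (h : IsStepLaw μη c) {b u : ℝ} (hcb : c ≤ b) (hb : b < u) (K : ℕ) :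
    (Measure.infinitePi fun _ : ℤ => μη)
        {η | (drivenBy (reflStep (u - b) b u) (0, false) η K).2 = true ∧
          (drivenBy (reflStep (u - b) b u) (0, false) η K).1 ≤ b}
      ≤ ENNReal.ofReal ((b + c) / (u + c - b)) := by
  have hc := h.nonneg
  have hD : 0 < u + c - b := by linarith
  let v : ℕ → ℝ × Bool → ℝ := fun _ s =>
    if s.2 = true then (if u ≤ s.1 then 0 else (u + c - s.1) / (u + c - b))
    else (b + c) / (u + c - b)
  have hq : 0 ≤ (b + c) / (u + c - b) := div_nonneg (by linarith) hD.le
  have key := measure_drivenBy_le μη (measurable_reflStep (u - b) b u) (0, false) (v := v)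
    (fun k => Measurable.ite (measurable_snd (MeasurableSet.singleton true))
      (Measurable.ite (measurableSet_le measurable_const measurable_fst) (by fun_prop)
        (by fun_prop)) measurable_const) (fun k s => ?_) K
  · refine (measure_mono fun η hη => ?_).trans (key.trans_eq ?_)
    · obtain ⟨h1, h2⟩ : (drivenBy (reflStep (u - b) b u) (0, false) η K).2 = true ∧
          (drivenBy (reflStep (u - b) b u) (0, false) η K).1 ≤ b := hη
      simp only [Set.mem_ofPred_eq, v]
      rw [if_pos h1, if_neg (by linarith), one_le_div hD]
      linarith
    · simp [v]
  · obtain ⟨y, f⟩ := s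
    cases f with
    | false =>
      have h1 := h.lintegral_le (F := fun t => v (k + 1) (reflStep (u - b) b u (y, false) t))
        (p := (b + c) / (u + c - b)) (q := 0) (r := 0) fun t ht => by
          simp only [zero_mul, add_zero]
          refine ⟨?_, hq⟩
          simp only [v, reflStep, if_true]
          by_cases h2 : u - b ≤ max (y + t) 0
          · simp only [h2, if_true]
            split_ifs
            · exact hq
            · exact div_le_div_of_nonneg_right (by linarith) hD.le
          · simp [h2]
      refine h1.trans_eq ?_
      simp [v]
    | true =>
      by_cases hy : b < y ∧ y < u
      · have h1 := h.lintegral_le (F := fun t => v (k + 1) (reflStep (u - b) b u (y, true) t))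
          (p := (u + c - y) / (u + c - b)) (q := -1 / (u + c - b)) (r := 0) fun t ht => by
            have ht' := abs_le.1 ht
            have h2 : (u + c - y) / (u + c - b) + -1 / (u + c - b) * t + 0 * t ^ 2
                = (u + c - (y + t)) / (u + c - b) := by ring
            have h3 : 0 ≤ (u + c - (y + t)) / (u + c - b) := div_nonneg (by linarith) hD.le
            have h4 : max (y + t) 0 = y + t := max_eq_left (by linarith)
            rw [h2]
            refine ⟨?_, h3⟩
            simp only [v, reflStep, hy, h4, if_true, and_self, Bool.true_eq_false, if_false]
            split_ifs
            · exact h3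
            · exact le_rfl
        refine h1.trans_eq ?_
        simp only [v, if_true]
        rw [if_neg (not_le.2 hy.2), zero_mul, add_zero]
      · simp only [reflStep, hy, if_false, Bool.true_eq_false, lintegral_const, measure_univ,
          mul_one]
        exact le_rfl

end

/-! ### The valley of the environment -/

section

variable {d : ℕ} {ω : Env d}

lemma walkS_zero (ω : Env d) : walkS ω ((0 : ℕ) : ℤ) = 0 := by simp [walkS]

lemma walkS_succ (ω : Env d) (k : ℕ) :
    walkS ω ((k + 1 : ℕ) : ℤ) = walkS ω k + ω.1 (k + 1) := by
  have h : Finset.Icc 1 ((k : ℤ) + 1) = insert ((k : ℤ) + 1) (Finset.Icc 1 (k : ℤ)) := by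
    ext i; simp only [Finset.mem_Icc, Finset.mem_insert]; omega
  rw [walkS, walkS, if_pos (by omega), if_pos (by omega), Nat.cast_succ, h,
    Finset.sum_insert (by simp), add_comm]

lemma abs_walkS_add_sub_le {c : ℝ} (hω : ∀ i, |ω.1 i| ≤ c) (k l : ℕ) :
    |walkS ω ((k + l : ℕ) : ℤ) - walkS ω k| ≤ c * l := by
  induction l with
  | zero => simp
  | succ l ih =>
    have h1 := walkS_succ ω (k + l)
    have h2 := abs_le.1 (hω ((k + l : ℕ) + 1))
    have h3 := abs_le.1 ih
    rw [← add_assoc, h1]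
    push_cast at *
    exact abs_le.2 ⟨by linarith, by linarith⟩

lemma abs_potential_sub_le {c : ℝ} {C : ℤ} (hω : ∀ i, |ω.1 i| ≤ c) (hδ : ∀ x, |ω.2 x| ≤ C)
    (x : Site d) : |potential ω x - walkS ω (supNorm x)| ≤ c * C := by
  have hc : 0 ≤ c := (abs_nonneg _).trans (hω 0)
  have hx := abs_le.1 (hδ x)
  rw [potential]
  split_ifs with h
  · rcases le_total 0 (ω.2 x) with h0 | h0
    · obtain ⟨l, hl⟩ := Int.eq_ofNat_of_zero_le h0
      have := abs_walkS_add_sub_le hω (supNorm x) l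
      rw [hl, ← Nat.cast_add]
      refine this.trans (mul_le_mul_of_nonneg_left ?_ hc)
      exact_mod_cast (by omega : (l : ℤ) ≤ C)
    · obtain ⟨k, hk⟩ := Int.eq_ofNat_of_zero_le h
      obtain ⟨l, hl⟩ : ∃ l : ℕ, k + l = supNorm x := ⟨supNorm x - k, by omega⟩
      have := abs_walkS_add_sub_le hω k l
      rw [hk, abs_sub_comm, ← hl]
      refine this.trans (mul_le_mul_of_nonneg_left ?_ hc)
      exact_mod_cast (by omega : (l : ℤ) ≤ C)
  · have := abs_walkS_add_sub_le hω 0 (supNorm x)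
    rw [walkS_zero, zero_add, sub_zero] at this
    rw [zero_sub, abs_neg]
    refine this.trans (mul_le_mul_of_nonneg_left ?_ hc)
    exact_mod_cast (by omega : (supNorm x : ℤ) ≤ C)

lemma runningMin_le (ω : Env d) {i k : ℕ} (h : i ≤ k) : runningMin ω k ≤ walkS ω i :=
  Finset.inf'_le (fun i : ℕ => walkS ω i) (Finset.mem_range.2 (by omega))

lemma exists_runningMin_eq (ω : Env d) (k : ℕ) : ∃ i ≤ k, runningMin ω k = walkS ω i := by
  obtain ⟨i, hi, h⟩ := Finset.exists_mem_eq_inf' (Finset.nonempty_range_add_one (n := k))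
    fun i : ℕ => walkS ω i
  exact ⟨i, by simpa [Nat.lt_succ_iff] using hi, h⟩

lemma le_runningMin {k : ℕ} {a : ℝ} (h : ∀ i ≤ k, a ≤ walkS ω i) : a ≤ runningMin ω k := by
  obtain ⟨i, hi, e⟩ := exists_runningMin_eq ω k
  rw [e]
  exact h i hi

lemma runningMin_anti (ω : Env d) {j k : ℕ} (h : j ≤ k) : runningMin ω k ≤ runningMin ω j :=
  le_runningMin fun _ hi => runningMin_le ω (hi.trans h)

/-- The walk reflected at its running minimum. -/
noncomputable def reflWalk (ω : Env d) (k : ℕ) : ℝ := walkS ω k - runningMin ω k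

lemma reflWalk_zero (ω : Env d) : reflWalk ω 0 = 0 := by
  obtain ⟨i, hi, e⟩ := exists_runningMin_eq ω 0
  rw [reflWalk, e, Nat.le_zero.1 hi, sub_self]

lemma reflWalk_succ (ω : Env d) (k : ℕ) :
    reflWalk ω (k + 1) = max (reflWalk ω k + ω.1 (k + 1)) 0 := by
  have h1 : runningMin ω (k + 1) = min (runningMin ω k) (walkS ω ((k + 1 : ℕ) : ℤ)) := by
    refine le_antisymm (le_min (runningMin_anti ω (by omega)) (runningMin_le ω le_rfl)) ?_
    refine le_runningMin fun i hi => ?_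
    rcases Nat.le_succ_iff.1 hi with h | rfl
    · exact (min_le_left _ _).trans (runningMin_le ω h)
    · exact min_le_right _ _
  rw [reflWalk, h1, reflWalk, walkS_succ]
  rcases le_total (runningMin ω k) (walkS ω k + ω.1 (k + 1)) with h | h
  · rw [min_eq_left h, max_eq_left (by linarith)]; ring
  · rw [min_eq_right h, max_eq_right (by linarith)]; ring

lemma exists_stop_eq (ω : Env d) (a u : ℝ) (k : ℕ) :
    ∃ j ≤ k, drivenBy (stopStep a u) 0 ω.1 k = walkS ω j ∧
      (∀ i < j, -a < walkS ω i ∧ walkS ω i < u) ∧ (j = k ∨ ¬(-a < walkS ω j ∧ walkS ω j < u)) := by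
  induction k with
  | zero => exact ⟨0, le_rfl, by simp [drivenBy, walkS], by simp, Or.inl rfl⟩
  | succ k ih =>
    obtain ⟨j, hj, h1, h2, h3⟩ := ih
    rw [drivenBy, stopStep, h1]
    by_cases h4 : -a < walkS ω j ∧ walkS ω j < u
    · obtain rfl : j = k := h3.resolve_right (not_not.2 h4)
      refine ⟨j + 1, le_rfl, by rw [if_pos h4, walkS_succ], fun i hi => ?_, Or.inl rfl⟩
      rcases Nat.lt_succ_iff_lt_or_eq.1 hi with h | rfl
      exacts [h2 i h, h4]
    · exact ⟨j, by omega, by rw [if_neg h4], h2, Or.inr h4⟩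

/-- The flagged process is frozen below `b`, so the event at a late time contains those at all
earlier times. -/
lemma refl_absorbing (ω : Env d) {l b u : ℝ} {j k : ℕ} (hjk : j ≤ k)
    (h : (drivenBy (reflStep l b u) (0, false) ω.1 j).2 = true ∧
      (drivenBy (reflStep l b u) (0, false) ω.1 j).1 ≤ b) :
    (drivenBy (reflStep l b u) (0, false) ω.1 k).2 = true ∧
      (drivenBy (reflStep l b u) (0, false) ω.1 k).1 ≤ b := by
  induction k, hjk using Nat.le_induction with
  | base => exact h
  | succ k _ ih =>
    have e : reflStep l b u (drivenBy (reflStep l b u) (0, false) ω.1 k) (ω.1 (k + 1))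
        = drivenBy (reflStep l b u) (0, false) ω.1 k := by
      rw [reflStep, if_neg (by simp [ih.1]), if_neg (fun h => absurd ih.2 (not_le.2 h.1))]
    rw [drivenBy, e]
    exact ih

/-- If the reflected walk does not return to `b` between its first passage above `l` and its first
passage above `u`, then it stays above `b` after any visit above `l`. -/
lemma reflWalk_gt (ω : Env d) {l b u : ℝ} (hbl : b < l) (hl : 0 < l) {M K : ℕ} (hMK : M ≤ K)
    (hM : ∀ i < M, reflWalk ω i < u)
    (h : ¬((drivenBy (reflStep l b u) (0, false) ω.1 K).2 = true ∧
      (drivenBy (reflStep l b u) (0, false) ω.1 K).1 ≤ b))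
    {i j : ℕ} (hij : i ≤ j) (hjM : j ≤ M) (hi : l ≤ reflWalk ω i) : b < reflWalk ω j := by
  have key : ∀ k ≤ M,
      (drivenBy (reflStep l b u) (0, false) ω.1 k = (reflWalk ω k, false) ∧
        ∀ i ≤ k, reflWalk ω i < l) ∨
      (drivenBy (reflStep l b u) (0, false) ω.1 k = (reflWalk ω k, true) ∧ b < reflWalk ω k ∧
        ∀ i j, i ≤ j → j ≤ k → l ≤ reflWalk ω i → b < reflWalk ω j) := by
    intro k
    induction k with
    | zero =>
      intro _
      refine Or.inl ⟨by rw [drivenBy, reflWalk_zero], fun i hi => ?_⟩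
      rw [Nat.le_zero.1 hi, reflWalk_zero]
      exact hl
    | succ k ih =>
      intro hk
      have hnot : ¬((drivenBy (reflStep l b u) (0, false) ω.1 (k + 1)).2 = true ∧
          (drivenBy (reflStep l b u) (0, false) ω.1 (k + 1)).1 ≤ b) :=
        fun h' => h (refl_absorbing ω (hk.trans hMK) h')
      rcases ih (by omega) with ⟨h1, h2⟩ | ⟨h1, h2, h3⟩
      · have e : drivenBy (reflStep l b u) (0, false) ω.1 (k + 1)
            = (reflWalk ω (k + 1), if l ≤ reflWalk ω (k + 1) then true else false) := by
          rw [drivenBy, h1, reflWalk_succ, reflStep, if_pos rfl]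
        by_cases h4 : l ≤ reflWalk ω (k + 1)
        · rw [if_pos h4] at e
          refine Or.inr ⟨e, hbl.trans_le h4, fun i j hij hj hi => ?_⟩
          have : i = k + 1 := by
            by_contra hne
            exact absurd hi (not_le.2 (h2 i (by omega)))
          rw [show j = k + 1 by omega]
          exact hbl.trans_le h4
        · rw [if_neg h4] at e
          refine Or.inl ⟨e, fun i hi => ?_⟩
          rcases Nat.le_succ_iff.1 hi with h5 | rfl
          exacts [h2 i h5, not_le.1 h4]
      · have e : drivenBy (reflStep l b u) (0, false) ω.1 (k + 1)
            = (reflWalk ω (k + 1), true) := by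
          rw [drivenBy, h1, reflWalk_succ, reflStep, if_neg (by simp),
            if_pos ⟨h2, hM k (by omega)⟩]
        rw [e] at hnot
        have h4 : b < reflWalk ω (k + 1) := by
          by_contra h5
          exact hnot ⟨rfl, not_lt.1 h5⟩
        refine Or.inr ⟨e, h4, fun i j hij hj hi => ?_⟩
        rcases Nat.le_succ_iff.1 hj with h5 | rfl
        exacts [h3 i j hij h5 hi, h4]
  rcases key M le_rfl with ⟨_, h2⟩ | ⟨_, _, h3⟩
  · exact absurd hi (not_le.2 (h2 i (hij.trans hjM)))
  · exact h3 i j hij hjM hi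

/-- On the good event the environment has a valley. -/
lemma isValley_of_good {n K : ℕ} {a b c u κ : ℝ} {C : ℤ} (hω : ∀ i, |ω.1 i| ≤ c)
    (hδ : ∀ x, |ω.2 x| ≤ C) (hκ : c * C ≤ κ) (hκ' : c ≤ κ)
    (hu : u = Real.log n + √(Real.log n)) (hu0 : 0 < u) (hb : 0 < b) (hbu : b < u - b)
    (h1 : u ≤ drivenBy (stopStep a u) 0 ω.1 K)
    (h2 : ¬((drivenBy (reflStep (u - b) b u) (0, false) ω.1 K).2 = true ∧
      (drivenBy (reflStep (u - b) b u) (0, false) ω.1 K).1 ≤ b))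
    (h3 : ¬(u - 1 ≤ drivenBy (stopStep 1 (u - 1)) 0 ω.1 K)) :
    topM ω n ≤ K ∧
      IsValley (potential ω) (fun j => walkS ω j) (bottomM ω n) (topM ω n) κ (u - b) u := by
  set S : ℕ → ℝ := fun j => walkS ω j with hS
  have hS0 : S 0 = 0 := walkS_zero ω
  obtain ⟨J, hJK, hJ1, hJ2, -⟩ := exists_stop_eq ω a u K
  rw [hJ1] at h1
  have hJ0 : 0 < J := by
    rcases Nat.eq_zero_or_pos J with rfl | h
    · have : walkS ω ((0 : ℕ) : ℤ) = 0 := walkS_zero ω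
      linarith
    · exact h
  have hset : topM ω n = sInf {k : ℕ | 0 < k ∧ u ≤ reflWalk ω k} := by
    rw [topM, hu]; rfl
  -- The walk reaches `u` before `-a`, and its running minimum is at most `S_0 = 0`. Hence the set
  -- defining `topM` is nonempty and the infimum is not the default `0`.
  have hJmem : J ∈ {k : ℕ | 0 < k ∧ u ≤ reflWalk ω k} := by
    refine ⟨hJ0, ?_⟩
    have := runningMin_le ω (Nat.zero_le J)
    rw [walkS_zero] at this
    rw [reflWalk]
    linarith
  set M := topM ω n with hM
  have hMmem : 0 < M ∧ u ≤ reflWalk ω M := by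
    have := Nat.sInf_mem ⟨J, hJmem⟩
    rw [← hset] at this
    exact this
  have hMJ : M ≤ J := by rw [hset]; exact Nat.sInf_le hJmem
  have hMK := hMJ.trans hJK
  have hlt : ∀ i < M, reflWalk ω i < u := by
    intro i hi
    rcases Nat.eq_zero_or_pos i with rfl | h0
    · rw [reflWalk_zero]; exact hu0
    · by_contra hcon
      rw [hset] at hi
      exact Nat.notMem_of_lt_sInf hi ⟨h0, not_lt.1 hcon⟩
  -- A visit below `-1` before `topM` rules out time `0` as the place of the minimum, so `bottomM`
  -- is a genuine positive time.
  obtain ⟨j, hjK, hj1, hj2, hj3⟩ := exists_stop_eq ω 1 (u - 1) K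
  rw [hj1] at h3
  have hjle : walkS ω j ≤ -1 := by
    by_contra hcon
    have hin : -1 < walkS ω j ∧ walkS ω j < u - 1 := ⟨not_le.1 hcon, not_le.1 h3⟩
    have hjK' : j = K := hj3.resolve_right (not_not.2 hin)
    rcases (hjK' ▸ hJK : J ≤ j).eq_or_lt with e | e
    · rw [e] at h1; linarith [hin.2]
    · linarith [(hj2 J e).2]
  have hjM : j ≤ M := by
    by_contra hcon
    have h4 : -1 ≤ runningMin ω M := le_runningMin fun i hi => (hj2 i (by omega)).1.le
    have h5 := (hj2 M (by omega)).2
    have h6 := hMmem.2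
    rw [reflWalk] at h6
    linarith
  have hbotset : {k : ℕ | 0 < k ∧ walkS ω (k : ℤ) = runningMin ω M}.Nonempty := by
    obtain ⟨i, hi, e⟩ := exists_runningMin_eq ω M
    refine ⟨i, ?_, e.symm⟩
    rcases Nat.eq_zero_or_pos i with rfl | h0
    · have h4 := runningMin_le ω hjM
      rw [e, walkS_zero] at h4
      linarith
    · exact h0
  set m := bottomM ω n with hm
  have hmmem : 0 < m ∧ walkS ω (m : ℤ) = runningMin ω M := Nat.sInf_mem hbotset
  have hmM' : m ≤ M := by
    obtain ⟨i, hi, e⟩ := exists_runningMin_eq ω M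
    refine le_trans (Nat.sInf_le ⟨?_, e.symm⟩) hi
    rcases Nat.eq_zero_or_pos i with rfl | h0
    · have h4 := runningMin_le ω hjM
      rw [e, walkS_zero] at h4
      linarith
    · exact h0
  have hgap : u ≤ walkS ω M - walkS ω m := by rw [hmmem.2]; exact hMmem.2
  have hmM : m < M := by
    refine lt_of_le_of_ne hmM' fun e => ?_
    rw [← e, sub_self] at hgap
    linarith
  have hrun : ∀ i, m ≤ i → i ≤ M → runningMin ω i = walkS ω m := by
    intro i h4 h5
    refine le_antisymm (runningMin_le ω h4) ?_
    rw [hmmem.2]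
    exact runningMin_anti ω h5
  have hgt : ∀ {i j : ℕ}, i ≤ j → j ≤ M → u - b ≤ reflWalk ω i → b < reflWalk ω j :=
    fun {i j} h4 h5 h6 => reflWalk_gt ω hbu (hb.trans hbu) hMK hlt h2 h4 h5 h6
  refine ⟨hMK, ⟨hmM, fun x => (abs_potential_sub_le hω hδ x).trans hκ, fun j => ?_,
    fun j hj => ?_, fun i j hij hj => ?_, fun i j hi hij hj => ?_, hgap⟩⟩
  · have := abs_walkS_add_sub_le hω j 1
    simp only [Nat.cast_one, mul_one] at this
    exact this.trans hκ'
  · change walkS ω m ≤ walkS ω j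
    rw [hmmem.2]
    exact runningMin_le ω hj
  -- A higher climb before `m` would keep the reflected walk above `b` up to `M`, whereas it
  -- vanishes at `m`.
  · change walkS ω j - walkS ω i ≤ u - b
    by_contra hcon
    have h4 := runningMin_le ω hij
    have h5 : u - b ≤ reflWalk ω j := by rw [reflWalk]; linarith
    have h6 := hgt hj hmM.le h5
    rw [reflWalk, hrun m le_rfl hmM.le, sub_self] at h6
    linarith
  -- After a larger drop the walk would still be more than `b` above the bottom, so it would have
  -- exceeded height `u` before `M`.
  · change walkS ω i - walkS ω j ≤ u - b
    by_contra hcon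
    have h4 : walkS ω m ≤ walkS ω j := by rw [hmmem.2]; exact runningMin_le ω hj
    have h5 := hrun i hi (hij.trans hj)
    have h6 : u - b ≤ reflWalk ω i := by rw [reflWalk, h5]; linarith
    have h7 := hgt hij hj h6
    rw [reflWalk, hrun j (hi.trans hij) hj] at h7
    rcases (hij.trans hj).lt_or_eq with h8 | h8
    · have h9 := hlt i h8
      rw [reflWalk, h5] at h9
      linarith
    · have : i = j := by omega
      subst this
      linarith

end

/-! ### The values of the reversible measure -/

lemma abs_le_of_mem_shiftSupport {μδ : Measure ℤ} {C : ℤ} (hδ : ∀ᵐ z ∂μδ, |z| ≤ C) {z : ℤ}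
    (hz : z ∈ shiftSupport μδ) : |z| ≤ C := by
  by_contra hcon
  have h1 := (ae_iff_of_countable.1 hδ) z (ne_of_gt hz)
  exact hcon h1

lemma finite_setOf_shifts (d : ℕ) {μδ : Measure ℤ} {C : ℤ} (hδ : ∀ᵐ z ∂μδ, |z| ≤ C) :
    {a : Fin (2 * d + 1) → ℤ | a 0 ∈ shiftSupport μδ ∧ ∀ i, a i ∈ extShiftSupport μδ}.Finite := by
  have h1 : extShiftSupport μδ ⊆ Set.Icc (-C - 1) (C + 1) := by
    rintro a ⟨z, hz, h⟩
    have := abs_le.1 (abs_le_of_mem_shiftSupport hδ hz)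
    rw [Set.mem_Icc]
    omega
  refine Set.Finite.subset (Set.Finite.pi' fun _ : Fin (2 * d + 1) =>
    (Set.finite_Icc (-C - 1) (C + 1))) ?_
  exact fun a ha i => h1 (ha.2 i)

/-- For `p ≥ C + 1` the site and its neighbours have radius at least `C`, so every potential
involved is a value of `S`. A neighbour's radius differs from `p` by at most one, which gives the
entries `z - 1`, `z`, `z + 1`. -/
lemma exists_formValue {d : ℕ} [NeZero d] {μδ : Measure ℤ} {C : ℤ} (hδ : ∀ᵐ z ∂μδ, |z| ≤ C)
    {ω : Env d} (hω : ∀ x, ω.2 x ∈ shiftSupport μδ) {p : ℤ} (hp : C + 1 ≤ p) {v : ℝ}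
    (hv : v ∈ levelValues (potential ω) p) :
    ∃ a : Fin (2 * d + 1) → ℤ, (a 0 ∈ shiftSupport μδ ∧ ∀ i, a i ∈ extShiftSupport μδ) ∧
      v = formValue ω p a := by
  obtain ⟨x, hx, rfl⟩ := Finset.mem_image.1 hv
  have hxp : (supNorm x : ℤ) = p := mem_shell.1 hx
  have hC : ∀ y, -C ≤ ω.2 y := fun y => (abs_le.1 (abs_le_of_mem_shiftSupport hδ (hω y))).1
  let e : Fin (2 * d) ≃ neighbors x := ((neighbors x).equivFinOfCardEq (card_neighbors x)).symm
  have hnb : ∀ y ∈ neighbors x, supNorm y ≤ supNorm x + 1 ∧ supNorm x ≤ supNorm y + 1 :=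
    fun y hy => ⟨supNorm_le_of_mem_neighbors hy,
      supNorm_le_of_mem_neighbors (mem_neighbors_comm.1 hy)⟩
  let a : Fin (2 * d + 1) → ℤ := Fin.cons (ω.2 x)
    fun i => (supNorm (e i : Site d) : ℤ) - p + ω.2 (e i)
  refine ⟨a, ⟨hω x, fun i => ?_⟩, ?_⟩
  · refine Fin.cases ?_ (fun i => ?_) i
    · exact ⟨ω.2 x, hω x, Or.inr (Or.inl rfl)⟩
    · refine ⟨ω.2 (e i), hω _, ?_⟩
      have := hnb _ (e i).2
      simp only [a, Fin.cons_succ]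
      omega
  · have h1 : ∀ y, C ≤ supNorm y → potential ω y = walkS ω ((supNorm y : ℤ) + ω.2 y) := by
      intro y hy
      rw [potential, if_pos]
      have := hC y
      omega
    have h2 : revMeasure (potential ω) x
        = ∑ y ∈ neighbors x, Real.exp (-(1 / 2) * potential ω x)
            * Real.exp (-(1 / 2) * potential ω y) := by
      refine Finset.sum_congr rfl fun y hy => ?_
      rw [conductance, if_pos hy, ← Real.exp_add]
      congr 1
      ring
    rw [h2, ← Finset.mul_sum, formValue, h1 x (by omega), hxp]
    congr 1
    rw [← Finset.sum_coe_sort, ← Equiv.sum_comp e]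
    refine Finset.sum_congr rfl fun i _ => ?_
    have h3 := hnb _ (e i).2
    rw [h1 _ (by omega)]
    simp only [a, Fin.cons_succ]
    congr 3
    ring

/-- Almost surely the increments are bounded and the shifts are atoms of their law. -/
lemma ae_envLaw (d : ℕ) (μη : Measure ℝ) [IsProbabilityMeasure μη] (μδ : Measure ℤ)
    [IsProbabilityMeasure μδ] {c : ℝ} (hη : ∀ᵐ t ∂μη, |t| ≤ c) :
    ∀ᵐ ω ∂envLaw d μη μδ, (∀ i, |ω.1 i| ≤ c) ∧ ∀ x, ω.2 x ∈ shiftSupport μδ := by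
  have h1 : ∀ᵐ η ∂(Measure.infinitePi fun _ : ℤ => μη), ∀ i, |η i| ≤ c := by
    rw [ae_all_iff]
    exact fun i => (measurePreserving_eval_infinitePi (fun _ : ℤ => μη) i).quasiMeasurePreserving.ae
      hη
  have h0 : ∀ᵐ z ∂μδ, z ∈ shiftSupport μδ := by
    rw [ae_iff_of_countable]
    exact fun z hz => pos_iff_ne_zero.2 hz
  have h2 : ∀ᵐ δ ∂(Measure.infinitePi fun _ : Site d => μδ), ∀ x, δ x ∈ shiftSupport μδ := by
    rw [ae_all_iff]
    exact fun x => (measurePreserving_eval_infinitePi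
      (fun _ : Site d => μδ) x).quasiMeasurePreserving.ae h0
  have h3 := (Measure.quasiMeasurePreserving_fst (μ := Measure.infinitePi fun _ : ℤ => μη)
    (ν := Measure.infinitePi fun _ : Site d => μδ)).ae h1
  have h4 := (Measure.quasiMeasurePreserving_snd (μ := Measure.infinitePi fun _ : ℤ => μη)
    (ν := Measure.infinitePi fun _ : Site d => μδ)).ae h2
  unfold envLaw
  filter_upwards [h3, h4] with ω h5 h6 using ⟨h5, h6⟩

/-! ### Concentration of all local times near the bottom of a valley -/

section

variable {d : ℕ} {V : Site d → ℝ} {s : ℕ → ℝ} {m M : ℕ} {κ Λ Γ : ℝ}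

lemma IsValley.abs_sub_le (h : IsValley V s m M κ Λ Γ) (i l : ℕ) : |s (i + l) - s i| ≤ κ * l := by
  induction l with
  | zero => simp
  | succ l ih =>
    have h1 := abs_le.1 (h.step (i + l))
    have h2 := abs_le.1 ih
    rw [← add_assoc]
    push_cast
    exact abs_le.2 ⟨by linarith, by linarith⟩

/-- Climbing a height `Γ` with steps at most `κ` takes more than `k` steps. -/
lemma IsValley.lt_top (h : IsValley V s m M κ Λ Γ) {k : ℕ} (hk : κ * k < Γ) : m + k < M := by
  by_contra hcon
  obtain ⟨l, rfl⟩ : ∃ l, M = m + l := ⟨M - m, by have := h.lt; omega⟩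
  have h1 := (abs_le.1 (h.abs_sub_le m l)).2
  have h2 := h.gap
  have h3 : κ * l ≤ κ * k :=
    mul_le_mul_of_nonneg_left (by exact_mod_cast (by omega : l ≤ k)) h.nonneg
  linarith

/-- The stationary mass of a site near the bottom of a valley. -/
lemma IsValley.le_mass [NeZero d] (h : IsValley V s m M κ Λ Γ) {k : ℕ} {Q : ℝ}
    (hQ : ((2 * M + 1 : ℕ) : ℝ) ≤ Q) {x : Site d} (h1 : m ≤ supNorm x + k)
    (h2 : supNorm x ≤ m + k) (hx : supNorm x ≤ M) :
    1 ≤ (2 * d * Real.exp ((k + 4) * κ) * Q ^ d) *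
      (revMeasure V x / ∑ y ∈ box d M, revMeasure V y) := by
  have hmem : ∀ y, y ∈ box d M ↔ supNorm y ≤ M := fun y => by rw [mem_box]; norm_cast
  have hZ : 0 < ∑ y ∈ box d M, revMeasure V y :=
    Finset.sum_pos (fun y _ => revMeasure_pos V y) ⟨x, (hmem x).2 hx⟩
  have hZle : ∑ y ∈ box d M, revMeasure V y ≤ Q ^ d * (2 * d * Real.exp (-s m + 2 * κ)) := by
    have h3 : ∀ y ∈ box d M, revMeasure V y ≤ 2 * d * Real.exp (-s m + 2 * κ) := by
      intro y hy
      refine (h.revMeasure_le y).trans (mul_le_mul_of_nonneg_left ?_ (by positivity))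
      have := h.bot _ ((hmem y).1 hy)
      exact Real.exp_le_exp.2 (by linarith)
    refine (Finset.sum_le_card_nsmul _ _ _ h3).trans ?_
    rw [card_box, nsmul_eq_mul, Nat.cast_pow]
    exact mul_le_mul_of_nonneg_right (pow_le_pow_left₀ (Nat.cast_nonneg _) hQ d) (by positivity)
  have hsx : s (supNorm x) ≤ s m + k * κ := by
    have hκ := h.nonneg
    rcases le_total m (supNorm x) with h3 | h3
    · obtain ⟨l, hl⟩ := Nat.exists_eq_add_of_le h3
      have h4 := (abs_le.1 (h.abs_sub_le m l)).2
      have h5 : κ * l ≤ κ * k := mul_le_mul_of_nonneg_left (by exact_mod_cast (by omega)) hκ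
      rw [hl]; linarith
    · obtain ⟨l, hl⟩ := Nat.exists_eq_add_of_le h3
      have h4 := (abs_le.1 (h.abs_sub_le (supNorm x) l)).1
      have h5 : κ * l ≤ κ * k := mul_le_mul_of_nonneg_left (by exact_mod_cast (by omega)) hκ
      rw [← hl] at h4; linarith
  have hpi : Real.exp (-s m - (k + 2) * κ) ≤ revMeasure V x :=
    (Real.exp_le_exp.2 (by linarith)).trans (h.le_revMeasure x)
  rw [← mul_div_assoc, one_le_div hZ]
  have hQ0 : 0 ≤ Q := (Nat.cast_nonneg _).trans hQ
  calc ∑ y ∈ box d M, revMeasure V y ≤ Q ^ d * (2 * d * Real.exp (-s m + 2 * κ)) := hZle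
    _ = 2 * d * Real.exp ((k + 4) * κ) * Q ^ d * Real.exp (-s m - (k + 2) * κ) := by
        have : Real.exp (-s m + 2 * κ)
            = Real.exp ((k + 4) * κ) * Real.exp (-s m - (k + 2) * κ) := by
          rw [← Real.exp_add]; congr 1; ring
        rw [this]; ring
    _ ≤ _ := mul_le_mul_of_nonneg_left hpi (by positivity)

/-- With `Λ = log n - y` one has `e^Λ = n e^{-y}`; the additive `1` is absorbed because `n e^{-y} ≥
1`. -/
lemma valleyTime_add_one_le {n : ℕ} (hn : 0 < n) {y Q : ℝ} (hy : y ≤ Real.log n)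
    (hQ : ((2 * M + 1 : ℕ) : ℝ) ≤ Q) :
    valleyTime d M κ (Real.log n - y) + 1
      ≤ n * ((8 * d * (d + 2) ^ 2 * Real.exp (3 * κ) + 1) * (Q ^ (d + 2) * Real.exp (-y))) := by
  have hn' : (0 : ℝ) < n := Nat.cast_pos.2 hn
  have hM0 : (0 : ℝ) ≤ M := Nat.cast_nonneg M
  have hQ1 : 1 ≤ Q := le_trans (by push_cast; linarith) hQ
  have hQ0 : 0 ≤ Q := by linarith
  have h2M : (2 * M : ℝ) ≤ Q := le_trans (by push_cast; linarith) hQ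
  have h1 : Real.exp (Real.log n - y + 3 * κ) = n * (Real.exp (3 * κ) * Real.exp (-y)) := by
    rw [← Real.exp_log hn', Real.log_exp, ← Real.exp_add, ← Real.exp_add]
    congr 1; ring
  have h2 : (1 : ℝ) ≤ n * Real.exp (-y) := by
    rw [← Real.exp_log hn', ← Real.exp_add]
    exact Real.one_le_exp (by linarith)
  have h3 : (1 : ℝ) ≤ Q ^ (d + 2) * (n * Real.exp (-y)) :=
    one_le_mul_of_one_le_of_one_le (one_le_pow₀ hQ1) h2
  have h4 : valleyTime d M κ (Real.log n - y)
      ≤ 2 * (Q ^ d * (4 * d * ((d + 2) * Q) ^ 2 * (n * (Real.exp (3 * κ) * Real.exp (-y))))) := by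
    rw [valleyTime, h1]
    push_cast at hQ ⊢
    gcongr
  calc valleyTime d M κ (Real.log n - y) + 1
      ≤ 2 * (Q ^ d * (4 * d * ((d + 2) * Q) ^ 2 * (n * (Real.exp (3 * κ) * Real.exp (-y)))))
          + Q ^ (d + 2) * (n * Real.exp (-y)) := add_le_add h4 h3
    _ = _ := by ring

/-- The local times near the bottom of a valley. -/
theorem IsValley.localTime_concentration_near_bottom [NeZero d] {n : ℕ} (hn : 0 < n) {y : ℝ}
    (h : IsValley V s m M κ (Real.log n - y) (Real.log n + y)) (hd : 2 ≤ d)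
    (hy : y ≤ Real.log n) {Q : ℝ} (hQ : ((2 * M + 1 : ℕ) : ℝ) ≤ Q) {k : ℕ}
    (hk : κ * k < Real.log n + y) {δ θ : ℝ} (hδ : 0 < δ)
    (hθ : θ = (8 * d * (d + 2) ^ 2 * Real.exp (3 * κ) + 1) * (2 * d * Real.exp ((k + 4) * κ)) *
      (Q ^ (2 * d + 2) * Real.exp (-y))) (hθ1 : θ ≤ 1) (hθδ : θ ≤ δ / 4) :
    quenchedLaw V 0 {X | ¬ ∀ x : Site d, m ≤ supNorm x + k → supNorm x ≤ m + k →
        |localTime X x n / n - revMeasure V x / ∑ y ∈ box d M, revMeasure V y|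
          ≤ δ * (revMeasure V x / ∑ y ∈ box d M, revMeasure V y)}
      ≤ ENNReal.ofReal (Q ^ d * (Q ^ d * (2 * d * Real.exp (4 * κ)) * Real.exp (-y)
          + 16 / δ ^ 2 * θ)) := by
  have hn' : (0 : ℝ) < n := Nat.cast_pos.2 hn
  have hkM := h.lt_top hk
  have hQ0 : 0 ≤ Q := (Nat.cast_nonneg _).trans hQ
  have hmem : ∀ y, y ∈ box d M ↔ supNorm y ≤ M := fun y => by rw [mem_box]; norm_cast
  -- The extra `1` gives `T + 1 ≤ 2 T`. As `θ` is chosen so that `T ≤ θ ρ n`, the bound `θ ≤ δ / 4`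
  -- then yields `T + 1 ≤ δ ρ n / 2`.
  set T : ℝ := valleyTime d M κ (Real.log n - y) + 1 with hT
  have hT1 : 1 ≤ T := by
    have := valleyTime_nonneg d M κ (Real.log n - y)
    linarith
  set a : ℝ := Q ^ d * (2 * d * Real.exp (4 * κ)) * Real.exp (-y) + 16 / δ ^ 2 * θ with ha
  have hθ0 : 0 ≤ θ := by rw [hθ]; positivity
  have ha0 : 0 ≤ a := by positivity
  have hsite : ∀ x : Site d, m ≤ supNorm x + k → supNorm x ≤ m + k →
      quenchedLaw V 0 {X | ¬
        |localTime X x n / n - revMeasure V x / ∑ y ∈ box d M, revMeasure V y|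
          ≤ δ * (revMeasure V x / ∑ y ∈ box d M, revMeasure V y)} ≤ ENNReal.ofReal a := by
    intro x hx1 hx2
    have hxM : supNorm x ≤ M := by omega
    obtain ⟨ρ, hρ⟩ : ∃ ρ, ρ = revMeasure V x / ∑ y ∈ box d M, revMeasure V y := ⟨_, rfl⟩
    have hmass := h.le_mass hQ hx1 hx2 hxM
    rw [← hρ] at hmass ⊢
    have hρ0 : 0 < ρ := by
      by_contra hcon
      have : (2 * d * Real.exp ((k + 4) * κ) * Q ^ d) * ρ ≤ 0 :=
        mul_nonpos_of_nonneg_of_nonpos (by positivity) (not_lt.1 hcon)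
      linarith
    have hTθ : T ≤ θ * (ρ * n) := by
      have h1 := valleyTime_add_one_le (d := d) (κ := κ) hn hy hQ
      calc T ≤ _ := h1
        _ ≤ _ := le_mul_of_one_le_right (by positivity) hmass
        _ = θ * (ρ * n) := by rw [hθ]; ring
    have hρn : 0 < ρ * n := by positivity
    have hT2 : T + 1 ≤ δ * ρ * n / 2 := by
      have := mul_le_mul_of_nonneg_right hθδ hρn.le
      linarith
    refine (h.localTime_concentration hd ((hmem x).2 hxM) hρ
      (by linarith : valleyTime d M κ (Real.log n - y) ≤ T) hT2).trans
      (ENNReal.ofReal_le_ofReal (add_le_add ?_ ?_))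
    · have h1 : Real.exp (4 * κ - (Real.log n + y))
          = Real.exp (4 * κ) * Real.exp (-y) / n := by
        rw [← Real.exp_log hn', ← Real.exp_add, ← Real.exp_sub, Real.log_exp]
        congr 1; ring
      rw [h1]
      calc (n : ℝ) * (((2 * M + 1 : ℕ) : ℝ) ^ d * (2 * d * (Real.exp (4 * κ) * Real.exp (-y) / n)))
          = ((2 * M + 1 : ℕ) : ℝ) ^ d * (2 * d * Real.exp (4 * κ)) * Real.exp (-y) := by
            field_simp
        _ ≤ _ := by gcongr
    · rw [div_le_iff₀ (by positivity)]
      have h1 : 16 / δ ^ 2 * θ * (δ * ρ * n / 2) ^ 2 = 4 * θ * (ρ * n) ^ 2 := by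
        field_simp; ring
      rw [h1]
      have h2 : T ^ 2 ≤ θ * (ρ * n) ^ 2 := by
        calc T ^ 2 ≤ (θ * (ρ * n)) ^ 2 := pow_le_pow_left₀ (by linarith) hTθ 2
          _ = θ * (θ * (ρ * n) ^ 2) := by ring
          _ ≤ 1 * (θ * (ρ * n) ^ 2) := mul_le_mul_of_nonneg_right hθ1 (by positivity)
          _ = _ := one_mul _
      have h3 : T * (ρ * n) ≤ θ * (ρ * n) ^ 2 := by
        calc T * (ρ * n) ≤ θ * (ρ * n) * (ρ * n) := mul_le_mul_of_nonneg_right hTθ hρn.le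
          _ = _ := by ring
      linarith
  calc _ ≤ quenchedLaw V 0 (⋃ x ∈ (box d M).filter fun x => m ≤ supNorm x + k ∧
          supNorm x ≤ m + k, {X | ¬
        |localTime X x n / n - revMeasure V x / ∑ y ∈ box d M, revMeasure V y|
          ≤ δ * (revMeasure V x / ∑ y ∈ box d M, revMeasure V y)}) := by
        refine measure_mono fun X hX => ?_
        simp only [Set.mem_ofPred_eq, not_forall] at hX
        obtain ⟨x, h1, h2, h3⟩ := hX
        simp only [Set.mem_iUnion]
        exact ⟨x, Finset.mem_filter.2 ⟨(hmem x).2 (by omega), h1, h2⟩, h3⟩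
    _ ≤ ∑ x ∈ (box d M).filter fun x => m ≤ supNorm x + k ∧ supNorm x ≤ m + k,
          ENNReal.ofReal a :=
        (measure_biUnion_finset_le _ _).trans (Finset.sum_le_sum fun x hx =>
          hsite x (Finset.mem_filter.1 hx).2.1 (Finset.mem_filter.1 hx).2.2)
    _ ≤ ENNReal.ofReal (Q ^ d * a) := by
        rw [Finset.sum_const, nsmul_eq_mul, ENNReal.ofReal_mul (by positivity)]
        refine mul_le_mul_left ?_ _
        rw [← ENNReal.ofReal_natCast]
        refine ENNReal.ofReal_le_ofReal ?_
        have h1 : ((box d M).filter fun x => m ≤ supNorm x + k ∧ supNorm x ≤ m + k).card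
            ≤ (2 * M + 1) ^ d := by
          rw [← card_box]; exact Finset.card_filter_le _ _
        calc _ ≤ (((2 * M + 1) ^ d : ℕ) : ℝ) := Nat.cast_le.2 h1
          _ = ((2 * M + 1 : ℕ) : ℝ) ^ d := by push_cast; ring
          _ ≤ Q ^ d := pow_le_pow_left₀ (Nat.cast_nonneg _) hQ d

/-! ### Local times of level sets -/

lemma sum_weight [NeZero d] (V : Site d → ℝ) (M p : ℤ) :
    ∑ v ∈ levelValues V p, weight V M p v
      = ∑ x ∈ shell d p, revMeasure V x / ∑ y ∈ box d M, revMeasure V y := by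
  rw [levelValues, ← Finset.sum_fiberwise_of_maps_to (s := shell d p)
    (t := (shell d p).image (revMeasure V)) fun x hx => Finset.mem_image_of_mem _ hx]
  refine Finset.sum_congr rfl fun v _ => ?_
  rw [weight, levelSet, ← Finset.sum_div, Finset.sum_congr rfl fun x hx =>
    (Finset.mem_filter.1 hx).2, Finset.sum_const, nsmul_eq_mul]

lemma weight_eq_sum [NeZero d] (V : Site d → ℝ) (M p : ℤ) (v : ℝ) :
    weight V M p v = ∑ x ∈ levelSet V p v, revMeasure V x / ∑ y ∈ box d M, revMeasure V y := by
  rw [weight, ← Finset.sum_div, levelSet, Finset.sum_congr rfl fun x hx =>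
    (Finset.mem_filter.1 hx).2, Finset.sum_const, nsmul_eq_mul]

/-- The error is relative to `ρ x`, so the triangle inequality preserves `δ` for any finite set of
sites. -/
lemma abs_localTimeOn_sub_le {X : ℕ → Site d} {U : Finset (Site d)} {n : ℕ} {ρ : Site d → ℝ}
    {δ : ℝ} (h : ∀ x ∈ U, |localTime X x n / n - ρ x| ≤ δ * ρ x) :
    |localTimeOn X U n / n - ∑ x ∈ U, ρ x| ≤ δ * ∑ x ∈ U, ρ x := by
  rw [localTimeOn, Finset.sum_div, ← Finset.sum_sub_distrib, Finset.mul_sum]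
  exact (Finset.abs_sum_le_sum_abs _ _).trans (Finset.sum_le_sum h)

end

/-! ### The good environments -/

/-- A bound for the width of the valley. -/
noncomputable def valleyWidth (n : ℕ) : ℕ := ⌈(Real.log n + √(Real.log n)) ^ 6⌉₊

/-- The environments that have bounded increments, admissible shifts and a regular valley. -/
def goodEnv (d : ℕ) (μδ : Measure ℤ) (c κ : ℝ) (n : ℕ) : Set (Env d) :=
  {ω | (∀ i, |ω.1 i| ≤ c) ∧ (∀ x, ω.2 x ∈ shiftSupport μδ) ∧ topM ω n ≤ valleyWidth n ∧
    IsValley (potential ω) (fun j => walkS ω j) (bottomM ω n) (topM ω n) κ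
      (Real.log n - √(Real.log n)) (Real.log n + √(Real.log n))}

lemma tendsto_sqrt_log : Tendsto (fun n : ℕ => √(Real.log n)) atTop atTop :=
  Real.tendsto_sqrt_atTop.comp (Real.tendsto_log_atTop.comp tendsto_natCast_atTop_atTop)

lemma envLaw_fst_preimage_le (d : ℕ) (μη : Measure ℝ) [IsProbabilityMeasure μη] (μδ : Measure ℤ)
    [IsProbabilityMeasure μδ] (E : Set (ℤ → ℝ)) :
    envLaw d μη μδ {ω | ω.1 ∈ E} = (Measure.infinitePi fun _ : ℤ => μη) E := by
  have h : {ω : Env d | ω.1 ∈ E} = E ×ˢ Set.univ := by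
    ext ω
    simp
  rw [envLaw, h, Measure.prod_prod, measure_univ, mul_one]

lemma measure_compl_goodEnv_le (d : ℕ) (μη : Measure ℝ) [IsProbabilityMeasure μη] (μδ : Measure ℤ)
    [IsProbabilityMeasure μδ] {c κ : ℝ} {C : ℤ} (h : IsStepLaw μη c)
    (hv : 0 < ∫ t, t ^ 2 ∂μη) (hδ : ∀ᵐ z ∂μδ, |z| ≤ C) (hκ : c * C ≤ κ) (hκ' : c ≤ κ) {n : ℕ}
    (hy4 : 4 ≤ √(Real.log n)) (hyc : c ≤ √(Real.log n)) :
    envLaw d μη μδ (goodEnv d μδ c κ n)ᶜ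
      ≤ ENNReal.ofReal ((9 / (∫ t, t ^ 2 ∂μη) + 9 + c) / √(Real.log n)) := by
  have hc := h.nonneg
  obtain ⟨y, hy⟩ : ∃ y, y = √(Real.log n) := ⟨_, rfl⟩
  have hlog : Real.log n = y ^ 2 := by
    rw [hy, Real.sq_sqrt]
    by_contra hcon
    rw [Real.sqrt_eq_zero_of_nonpos (not_le.1 hcon).le] at hy4
    linarith
  obtain ⟨u, hu⟩ : ∃ u, u = Real.log n + √(Real.log n) := ⟨_, rfl⟩
  have hKu : (u ^ 6 : ℝ) ≤ valleyWidth n := by rw [valleyWidth, ← hu]; exact Nat.le_ceil _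
  rw [← hy] at hy4 hyc ⊢
  have huy : u = y ^ 2 + y := by rw [hu, hlog, Real.sqrt_sq (by linarith)]
  set K := valleyWidth n with hK
  set σ2 := ∫ t, t ^ 2 ∂μη with hσ2
  have hy0 : 0 < y := by linarith
  have hyu : y ≤ u := by rw [huy]; nlinarith
  have hu1 : 1 ≤ u := by linarith
  have hu0 : 0 < u := by linarith
  have hK0 : 0 < K := by
    have : (0 : ℝ) < K := lt_of_lt_of_le (by positivity) hKu
    exact_mod_cast this
  -- The lower barrier `-u²` is reached before `u` with probability of order `1/u`. Leaving `(-u²,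
  -- u)` takes time of order at most `u⁴`, far less than `K ≥ u⁶`. The choice `b = 2y` turns `u - b`
  -- into `log n - y`.
  set E1 : Set (ℤ → ℝ) := {η | drivenBy (stopStep (u ^ 2) u) 0 η K ≤ -(u ^ 2)} with hE1
  set E2 : Set (ℤ → ℝ) := {η | -(u ^ 2) < drivenBy (stopStep (u ^ 2) u) 0 η K ∧
    drivenBy (stopStep (u ^ 2) u) 0 η K < u} with hE2
  set E3 : Set (ℤ → ℝ) := {η | (drivenBy (reflStep (u - 2 * y) (2 * y) u) (0, false) η K).2 = true ∧
    (drivenBy (reflStep (u - 2 * y) (2 * y) u) (0, false) η K).1 ≤ 2 * y} with hE3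
  set E4 : Set (ℤ → ℝ) := {η | u - 1 ≤ drivenBy (stopStep 1 (u - 1)) 0 η K} with hE4
  set E5 : Set (Env d) := {ω | ¬((∀ i, |ω.1 i| ≤ c) ∧ ∀ x, ω.2 x ∈ shiftSupport μδ)} with hE5
  have hsub : (goodEnv d μδ c κ n)ᶜ ⊆ E5 ∪ ({ω | ω.1 ∈ E1} ∪ ({ω | ω.1 ∈ E2} ∪
      ({ω | ω.1 ∈ E3} ∪ {ω | ω.1 ∈ E4}))) := by
    intro ω hω
    by_contra hcon
    simp only [Set.mem_union, not_or] at hcon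
    obtain ⟨h5, h1, h2, h3, h4⟩ := hcon
    simp only [hE5, Set.mem_ofPred_eq, not_not] at h5
    simp only [hE1, Set.mem_ofPred_eq, not_le] at h1
    simp only [hE2, Set.mem_ofPred_eq, not_and, not_lt] at h2
    obtain ⟨h6, h7⟩ := isValley_of_good (ω := ω) (n := n) (K := K) (a := u ^ 2) (b := 2 * y)
      h5.1 (fun x => abs_le_of_mem_shiftSupport hδ (h5.2 x)) hκ hκ' hu hu0 (by linarith)
      (by rw [huy]; nlinarith) (h2 h1) h3 h4
    refine hω ⟨h5.1, h5.2, h6, ?_⟩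
    rw [← hu, ← hy, show Real.log n - y = u - 2 * y by rw [huy, hlog]; ring]
    exact h7
  have hm5 : envLaw d μη μδ E5 = 0 := ae_iff.1 (ae_envLaw d μη μδ h.bound)
  have hm1 : (Measure.infinitePi fun _ : ℤ => μη) E1 ≤ ENNReal.ofReal (2 / y) := by
    refine (h.stop_bot_le (by positivity) hu0 K).trans (ENNReal.ofReal_le_ofReal ?_)
    rw [div_le_div_iff₀ (by positivity) hy0]
    nlinarith
  have hm2 : (Measure.infinitePi fun _ : ℤ => μη) E2 ≤ ENNReal.ofReal (9 / σ2 / y) := by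
    refine (h.stop_time_le (w := 3 * u ^ 2) (by nlinarith) (by nlinarith) (by positivity) hu0 hv
      hK0).trans (ENNReal.ofReal_le_ofReal ?_)
    have h1 : (3 * u ^ 2) ^ 2 / (σ2 * K) ≤ (3 * u ^ 2) ^ 2 / (σ2 * u ^ 6) :=
      div_le_div_of_nonneg_left (by positivity) (by positivity)
        (mul_le_mul_of_nonneg_left hKu hv.le)
    refine h1.trans ?_
    have h2 : (3 * u ^ 2) ^ 2 / (σ2 * u ^ 6) = 9 / σ2 / u ^ 2 := by
      field_simp; ring
    rw [h2]
    exact div_le_div_of_nonneg_left (by positivity) hy0 (by nlinarith)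
  have hm3 : (Measure.infinitePi fun _ : ℤ => μη) E3 ≤ ENNReal.ofReal (6 / y) := by
    refine (h.refl_le (by linarith) (by rw [huy]; nlinarith) K).trans
      (ENNReal.ofReal_le_ofReal ?_)
    rw [huy, div_le_div_iff₀ (by nlinarith) hy0]
    nlinarith
  have hm4 : (Measure.infinitePi fun _ : ℤ => μη) E4 ≤ ENNReal.ofReal ((1 + c) / y) := by
    refine (h.stop_top_le one_pos (by linarith) K).trans (ENNReal.ofReal_le_ofReal ?_)
    rw [show 1 + (u - 1) = u by ring]
    exact div_le_div_of_nonneg_left (by linarith) hy0 hyu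
  calc envLaw d μη μδ (goodEnv d μδ c κ n)ᶜ
      ≤ envLaw d μη μδ E5 + (envLaw d μη μδ {ω | ω.1 ∈ E1} + (envLaw d μη μδ {ω | ω.1 ∈ E2} +
          (envLaw d μη μδ {ω | ω.1 ∈ E3} + envLaw d μη μδ {ω | ω.1 ∈ E4}))) := by
        refine (measure_mono hsub).trans ((measure_union_le _ _).trans (add_le_add le_rfl ?_))
        refine (measure_union_le _ _).trans (add_le_add le_rfl ?_)
        refine (measure_union_le _ _).trans (add_le_add le_rfl ?_)
        exact measure_union_le _ _
    _ ≤ 0 + (ENNReal.ofReal (2 / y) + (ENNReal.ofReal (9 / σ2 / y) + (ENNReal.ofReal (6 / y) +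
          ENNReal.ofReal ((1 + c) / y)))) := by
        simp only [envLaw_fst_preimage_le]
        exact add_le_add hm5.le (add_le_add hm1 (add_le_add hm2 (add_le_add hm3 hm4)))
    _ = _ := by
        rw [zero_add, ← ENNReal.ofReal_add (by positivity) (by positivity),
          ← ENNReal.ofReal_add (by positivity) (by positivity),
          ← ENNReal.ofReal_add (by positivity) (by positivity)]
        congr 1
        ring

lemma tendsto_measure_compl_goodEnv (d : ℕ) (μη : Measure ℝ) [IsProbabilityMeasure μη]
    (μδ : Measure ℤ) [IsProbabilityMeasure μδ] {c κ : ℝ} {C : ℤ} (h : IsStepLaw μη c)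
    (hv : 0 < ∫ t, t ^ 2 ∂μη) (hδ : ∀ᵐ z ∂μδ, |z| ≤ C) (hκ : c * C ≤ κ) (hκ' : c ≤ κ) :
    Tendsto (fun n => envLaw d μη μδ (goodEnv d μδ c κ n)ᶜ) atTop (𝓝 0) := by
  have h1 : Tendsto (fun n : ℕ => ENNReal.ofReal
      ((9 / (∫ t, t ^ 2 ∂μη) + 9 + c) / √(Real.log n))) atTop (𝓝 0) := by
    rw [← ENNReal.ofReal_zero]
    exact ENNReal.tendsto_ofReal (tendsto_const_nhds.div_atTop tendsto_sqrt_log)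
  refine tendsto_of_tendsto_of_tendsto_of_le_of_le' tendsto_const_nhds h1
    (Eventually.of_forall fun _ => zero_le) ?_
  filter_upwards [tendsto_sqrt_log.eventually_ge_atTop 4,
    tendsto_sqrt_log.eventually_ge_atTop c] with n h4 h5
  exact measure_compl_goodEnv_le d μη μδ h hv hδ hκ hκ' h4 h5

/-! ### The quenched estimate, uniformly over good environments -/

/-- For `y ≥ 1`, `131 y^12` dominates `2M + 1` whenever `M ≤ (y² + y)^6 + 1`, since `(2y²)^6 = 64
y^12` and `128 + 3 = 131`. -/
lemma tendsto_pow_mul_exp_neg (N : ℕ) :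
    Tendsto (fun y : ℝ => (131 * y ^ 12) ^ N * Real.exp (-y)) atTop (𝓝 0) := by
  have h1 := (Real.tendsto_pow_mul_exp_neg_atTop_nhds_zero (12 * N)).const_mul ((131 : ℝ) ^ N)
  rw [mul_zero] at h1
  refine h1.congr fun y => ?_
  rw [mul_pow, ← pow_mul]
  ring

/-- The error `ε` is fixed before the potential, which is the uniformity needed for an infimum over
environments. -/
lemma exists_quenched_bound {d : ℕ} [NeZero d] (hd : 2 ≤ d) {κ δ : ℝ} (hδ : 0 < δ) (k : ℕ) :
    ∃ ε : ℕ → ENNReal, Tendsto ε atTop (𝓝 0) ∧ ∀ᶠ n in atTop, ∀ (V : Site d → ℝ) (s : ℕ → ℝ)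
      (m M : ℕ), M ≤ valleyWidth n →
      IsValley V s m M κ (Real.log n - √(Real.log n)) (Real.log n + √(Real.log n)) →
      quenchedLaw V 0 {X | ¬ ∀ x : Site d, m ≤ supNorm x + k → supNorm x ≤ m + k →
        |localTime X x n / n - revMeasure V x / ∑ y ∈ box d M, revMeasure V y|
          ≤ δ * (revMeasure V x / ∑ y ∈ box d M, revMeasure V y)} ≤ ε n := by
  obtain ⟨A, hA⟩ : ∃ A : ℝ, A = (8 * d * (d + 2) ^ 2 * Real.exp (3 * κ) + 1) *
    (2 * d * Real.exp ((k + 4) * κ)) := ⟨_, rfl⟩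
  let Q : ℝ → ℝ := fun y => 131 * y ^ 12
  let θ : ℝ → ℝ := fun y => A * (Q y ^ (2 * d + 2) * Real.exp (-y))
  have hθ : Tendsto θ atTop (𝓝 0) := by
    have := (tendsto_pow_mul_exp_neg (2 * d + 2)).const_mul A
    rwa [mul_zero] at this
  let e : ℝ → ℝ := fun y => Q y ^ d * (Q y ^ d * (2 * d * Real.exp (4 * κ)) * Real.exp (-y)
    + 16 / δ ^ 2 * θ y)
  have he : Tendsto e atTop (𝓝 0) := by
    have h1 := ((tendsto_pow_mul_exp_neg (2 * d)).const_mul (2 * d * Real.exp (4 * κ))).add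
      ((tendsto_pow_mul_exp_neg (3 * d + 2)).const_mul (16 / δ ^ 2 * A))
    rw [mul_zero, mul_zero, add_zero] at h1
    refine h1.congr fun y => ?_
    simp only [e, θ, Q]
    ring
  refine ⟨fun n => ENNReal.ofReal (e (√(Real.log n))), ?_, ?_⟩
  · rw [← ENNReal.ofReal_zero]
    exact ENNReal.tendsto_ofReal (he.comp tendsto_sqrt_log)
  · have hθn := hθ.comp tendsto_sqrt_log
    filter_upwards [hθn.eventually_le_const (show (0 : ℝ) < 1 by norm_num),
      hθn.eventually_le_const (show (0 : ℝ) < δ / 4 by positivity), eventually_gt_atTop 0,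
      tendsto_sqrt_log.eventually_ge_atTop 1, tendsto_sqrt_log.eventually_gt_atTop (κ * k)]
      with n h1 h2 h3 h4 h5
    intro V s m M hM h
    have hlog : Real.log n = √(Real.log n) ^ 2 := by
      rw [Real.sq_sqrt]
      by_contra hcon
      rw [Real.sqrt_eq_zero_of_nonpos (not_le.1 hcon).le] at h4
      linarith
    have hyl : √(Real.log n) ≤ Real.log n := by nlinarith
    have hQ : ((2 * M + 1 : ℕ) : ℝ) ≤ Q (√(Real.log n)) := by
      obtain ⟨y, hy⟩ : ∃ y, y = √(Real.log n) := ⟨_, rfl⟩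
      have h6 : ((M : ℕ) : ℝ) ≤ (y ^ 2 + y) ^ 6 + 1 := by
        have h7 : (M : ℝ) ≤ valleyWidth n := Nat.cast_le.2 hM
        have h8 := (Nat.ceil_lt_add_one (a := (Real.log n + √(Real.log n)) ^ 6)
          (by positivity)).le
        rw [← valleyWidth] at h8
        refine h7.trans (h8.trans_eq ?_)
        rw [hy, ← hlog]
      rw [← hy] at h4 ⊢
      have h9 : (y ^ 2 + y) ^ 6 ≤ (2 * y ^ 2) ^ 6 :=
        pow_le_pow_left₀ (by positivity) (by nlinarith) 6
      have h10 : 1 ≤ y ^ 12 := one_le_pow₀ h4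
      have h11 : (2 * y ^ 2) ^ 6 = 64 * y ^ 12 := by ring
      simp only [Q]
      push_cast
      linarith
    refine (h.localTime_concentration_near_bottom h3 hd hyl hQ (by linarith) hδ
      (θ := θ (√(Real.log n))) (by rw [← hA]) h1 h2)

end HypercubeRWRE

/-! ### The proposition. -/

theorem mainTheorem3 (d : ℕ) [NeZero d] (hd : 2 ≤ d)
    (μη : Measure ℝ) [IsProbabilityMeasure μη] (μδ : Measure ℤ) [IsProbabilityMeasure μδ]
    (hmean : ∫ t, t ∂μη = 0) (hvar : 0 < variance (fun t : ℝ => t) μη)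
    (hη : ∃ c : ℝ, ∀ᵐ t ∂μη, |t| ≤ c) (hδ : ∃ c : ℤ, ∀ᵐ z ∂μδ, |z| ≤ c) :
    ∃ (N : ℕ) (a : Fin N → Fin (2 * d + 1) → ℤ) (p₀ : ℤ),
      (∀ j, a j 0 ∈ shiftSupport μδ) ∧ (∀ j i, a j i ∈ extShiftSupport μδ) ∧
      ∀ δ : ℝ, 0 < δ →
        ∃ A : ℕ → Set (Env d),
          (∀ n, MeasurableSet (A n)) ∧
          Tendsto (fun n => envLaw d μη μδ (A n)) atTop (𝓝 1) ∧
          (∀ n, ∀ ω ∈ A n, ∀ p : ℤ, p₀ ≤ p →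
            ∀ v ∈ levelValues (potential ω) p, ∃ j, v = formValue ω p (a j)) ∧
          ∀ k : ℕ,
            Tendsto (fun n : ℕ => ⨅ ω ∈ A n, quenchedLaw (potential ω) 0
              {X | ∀ l ∈ Finset.Icc (-(k : ℤ)) k,
                |localTimeOn X (shell d (bottomM ω n + l)) n / n
                    - ∑ v ∈ levelValues (potential ω) (bottomM ω n + l),
                        weight (potential ω) (topM ω n) (bottomM ω n + l) v|
                  ≤ δ * ∑ v ∈ levelValues (potential ω) (bottomM ω n + l),
                        weight (potential ω) (topM ω n) (bottomM ω n + l) v})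
              atTop (𝓝 1) ∧
            Tendsto (fun n : ℕ => ⨅ ω ∈ A n, quenchedLaw (potential ω) 0
              {X | ∀ l ∈ Finset.Icc (-(k : ℤ)) k,
                ∀ v ∈ levelValues (potential ω) (bottomM ω n + l),
                  |localTimeOn X (levelSet (potential ω) (bottomM ω n + l) v) n / n
                      - weight (potential ω) (topM ω n) (bottomM ω n + l) v|
                    ≤ δ * weight (potential ω) (topM ω n) (bottomM ω n + l) v})
              atTop (𝓝 1) := by
  obtain ⟨c, hc⟩ := hη
  obtain ⟨C, hC⟩ := hδ
  have hstep : IsStepLaw μη c := by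
    obtain ⟨t, ht⟩ := hc.exists
    exact ⟨(abs_nonneg t).trans ht, hc, hmean⟩
  have hv : 0 < ∫ t, t ^ 2 ∂μη := by
    rwa [variance_of_integral_eq_zero measurable_id'.aemeasurable hmean] at hvar
  have hfin := finite_setOf_shifts d hC
  set κ : ℝ := max c (c * C) with hκ
  refine ⟨hfin.toFinset.card, fun j => (hfin.toFinset.equivFin.symm j).1, C + 1,
    fun j => (hfin.mem_toFinset.1 (hfin.toFinset.equivFin.symm j).2).1,
    fun j => (hfin.mem_toFinset.1 (hfin.toFinset.equivFin.symm j).2).2, fun δ hδ => ?_⟩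
  set μ := envLaw d μη μδ with hμ
  have hprob : IsProbabilityMeasure μ := by rw [hμ]; unfold envLaw; infer_instance
  -- A measurable subset of the good environments whose complement has the same outer measure as
  -- theirs.
  let A : ℕ → Set (Env d) := fun n => (toMeasurable μ (goodEnv d μδ c κ n)ᶜ)ᶜ
  have hAgood : ∀ n, A n ⊆ goodEnv d μδ c κ n := fun n =>
    Set.compl_subset_comm.1 (subset_toMeasurable μ _)
  have hAmeas : ∀ n, MeasurableSet (A n) := fun n => (measurableSet_toMeasurable μ _).compl
  have hAlim : Tendsto (fun n => μ (A n)) atTop (𝓝 1) := by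
    have h1 := tendsto_measure_compl_goodEnv d μη μδ hstep hv hC (le_max_right _ _ : c * C ≤ κ)
      (le_max_left _ _)
    have h2 := ENNReal.Tendsto.sub (tendsto_const_nhds (x := (1 : ENNReal))) h1
      (Or.inl ENNReal.one_ne_top)
    rw [tsub_zero] at h2
    refine h2.congr fun n => ?_
    rw [measure_compl (measurableSet_toMeasurable μ _) (measure_ne_top _ _), measure_univ,
      measure_toMeasurable]
  -- An infimum over the empty set would be `∞`, so the upper bound `1` needs an environment in `A
  -- n`.
  have hne : ∀ᶠ n in atTop, (A n).Nonempty := by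
    filter_upwards [hAlim.eventually_const_lt (show (0 : ENNReal) < 1 by norm_num)] with n hn
    exact nonempty_of_measure_ne_zero hn.ne'
  refine ⟨A, hAmeas, hAlim, fun n ω hω p hp v hvp => ?_, fun k => ?_⟩
  · obtain ⟨a, ha, rfl⟩ := exists_formValue hC (hAgood n hω).2.1 hp hvp
    exact ⟨hfin.toFinset.equivFin ⟨a, hfin.mem_toFinset.2 ha⟩, by simp⟩
  obtain ⟨ε, hε, hbound⟩ := exists_quenched_bound (κ := κ) hd hδ k
  -- Both limits reduce to this: any event implied by the single-site estimates within distance `k`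
  -- of the bottom.
  have hlim : ∀ E : (n : ℕ) → Env d → Set (ℕ → Site d),
      (∀ n ω X, (∀ x : Site d, bottomM ω n ≤ supNorm x + k → supNorm x ≤ bottomM ω n + k →
        |localTime X x n / n - revMeasure (potential ω) x /
            ∑ y ∈ box d (topM ω n), revMeasure (potential ω) y|
          ≤ δ * (revMeasure (potential ω) x /
            ∑ y ∈ box d (topM ω n), revMeasure (potential ω) y)) → X ∈ E n ω) →
      Tendsto (fun n : ℕ => ⨅ ω ∈ A n, quenchedLaw (potential ω) 0 (E n ω)) atTop (𝓝 1) := by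
    intro E hE
    have hε' := ENNReal.Tendsto.sub (tendsto_const_nhds (x := (1 : ENNReal))) hε
      (Or.inl ENNReal.one_ne_top)
    rw [tsub_zero] at hε'
    have hq : ∀ ω : Env d, IsProbabilityMeasure (quenchedLaw (potential ω) 0) := fun ω => by
      unfold quenchedLaw; infer_instance
    refine tendsto_of_tendsto_of_tendsto_of_le_of_le' hε' tendsto_const_nhds ?_ ?_
    · filter_upwards [hbound] with n hn
      refine le_iInf₂ fun ω hω => ?_
      obtain ⟨-, -, h1, h2⟩ := hAgood n hω
      have h3 := hn _ _ _ _ h1 h2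
      have := hq ω
      -- Subadditivity alone is used, so `E n ω` need not be measurable.
      rw [tsub_le_iff_right, ← measure_univ (μ := quenchedLaw (potential ω) 0)]
      refine le_trans ?_ (add_le_add le_rfl h3)
      refine (measure_mono fun X _ => ?_).trans (measure_union_le _ _)
      by_cases hX : X ∈ E n ω
      · exact Or.inl hX
      · exact Or.inr fun h => hX (hE n ω X h)
    · filter_upwards [hne] with n ⟨ω, hω⟩
      have := hq ω
      exact (iInf₂_le ω hω).trans prob_le_one
  have hnear : ∀ (ω : Env d) (n : ℕ), ∀ l ∈ Finset.Icc (-(k : ℤ)) k,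
      ∀ x ∈ shell d (bottomM ω n + l), bottomM ω n ≤ supNorm x + k ∧
        supNorm x ≤ bottomM ω n + k := by
    intro ω n l hl x hx
    have h1 := mem_shell.1 hx
    have h2 := Finset.mem_Icc.1 hl
    omega
  refine ⟨hlim _ fun n ω X hX l hl => ?_, hlim _ fun n ω X hX l hl v _ => ?_⟩
  · rw [sum_weight]
    exact abs_localTimeOn_sub_le fun x hx => hX x (hnear ω n l hl x hx).1 (hnear ω n l hl x hx).2
  · rw [weight_eq_sum]
    refine abs_localTimeOn_sub_le fun x hx => ?_
    have hx' := (Finset.mem_filter.1 hx).1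
    exact hX x (hnear ω n l hl x hx').1 (hnear ω n l hl x hx').2
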